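/- Let $X$ be a separable real Banach space with a centered non-degenerate Gaussian measure $\mu$, let $H$ be its Cameron--Martin space (for $h\in H$, $\hat h$ denotes the element of the closure of $X^*$ in $L^2(X,\mu)$ with $h=\int_X \hat h(x)\,x\,d\mu(x)$, and $\langle h,k\rangle_H=\int_X\hat h\hat k\,d\mu$), and let $(e_i)$ be an orthonormal basis of $H$ with $\hat e_i\in X^*$. Let $\mathcal H_2$ be the space of Hilbert--Schmidt operators on $H$, $\mathscr{FC}^k_b(X)$ the space of functions $x\mapsto g(x_1^*(x),\dots,x_n^*(x))$ with $x_i^*\in X^*$, $g\in C^k_b(\mathbb R^n)$, and $W^{k,p}(X,\mu)$ the Gaussian Sobolev spaces (the completions of $\mathscr{FC}_b^\infty(X)$ with respect to the $L^p$ norms of the function and of its derivatives along $H$ up to order $k$, measured in Hilbert--Schmidt norms); for a Borel set $\Omega$, $W^{1,p}(\Omega,\mu)$ is defined by the same approximation procedure in $L^p(\Omega,\mu)$. Let $\rho$ be the Feyel--de La Pradelle Hausdorff--Gauss surface measure, $\rho(A)=\sup_F\int_X\theta_F(\{z\in F: x-\pi_Fx+z\in A\})\,d\mu(x)$, where $F$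 runs over the subspaces of $H$ of finite dimension $m\ge1$, $\pi_Fx=\sum_i\hat f_i(x)f_i$ for an orthonormal basis $(f_i)$ of $F$, and $\theta_F$ is the $(m-1)$-dimensional spherical Hausdorff measure on $F$ multiplied by $(2\pi)^{-m/2}e^{-|z|_H^2/2}$. Let $C_{k,p}$ be the Gaussian capacity, given for open $A$ by $C_{k,p}(A)=\inf\{\|f\|_{L^p(X,\mu)}: (I-L_p)^{-k/2}f\ge1\ \mu\text{-a.e. in }A\}$, with $L_p$ the generator of the Ornstein--Uhlenbeck semigroup. A Borel function $f$ is called $(k,p)$-precise if for every $\varepsilon>0$ there is an open set $A$ with $C_{k,p}(A)\le\varepsilon$ such that $f|_{X\setminus A}$ is continuous (likewise for $H$- and $\mathcal H_2$-valued functions). Let $G:X\to\mathbb R$ be a version of a function in $W^{3,q}(X,\mu)$ for every $q>1$, put $\Omega=G^{-1}(-\infty,0]$, and let versions $\nabla_HG:X\to H$ and $\nabla_H^2G:X\to\mathcal H_2$ of its first and second derivatives along $H$ be fixed such that: 1. $G$ is convex and $(3,q)$-precise for every $q>1$; 2. $\nabla_HG$ is $(2,q)$-precise and $\nabla^2_HG$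 is $(1,q)$-precise for every $q>1$; 3. $\mu(\Omega)>0$ and $\Omega$ is closed; 4. $|\nabla_HG|_H^{-1}\in L^q(\Omega,\mu)$ for every $q>1$; 5. for $\rho$-a.e. $x\in G^{-1}(0)$, as $t\to0$, $\frac{G(x+th)-G(x)}t\to\langle\nabla_HG(x),h\rangle_H$ and $\frac{\nabla_HG(x+th)-\nabla_HG(x)}t\to\nabla_H^2G(x)h$ in $H$, uniformly with respect to $h\in H$ with $|h|_H=1$; 6. $\nabla_HG(x)\ne0$ for $\rho$-a.e. $x\in G^{-1}(0)$. For $p>1$ and $\varphi\in W^{1,p}(\Omega,\mu)$ let $\operatorname{Tr}\varphi$ be the trace of $\varphi$ on $G^{-1}(0)$, that is the limit in $L^1(G^{-1}(0),\rho)$ of $\varphi_n|_{G^{-1}(0)}$, where $(\varphi_n)$ are bounded Lipschitz functions on $\Omega$ converging to $\varphi$ in $W^{1,p}(\Omega,\mu)$; traces of $H$-valued and operator-valued functions are taken componentwise with respect to $(e_i)$. Let $\Phi\in\mathcal Z(\Omega,H)$, that is $\Phi=\sum_{i=1}^n\varphi_ih_i$ with $n\in\mathbb N$, $h_i\in H$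 and $\varphi_i$ restrictions to $\Omega$ of functions in $\mathscr{FC}^2_b(X)$, and $\langle\Phi,\operatorname{Tr}(\nabla_HG)\rangle_H=0$ $\rho$-a.e. in $G^{-1}(0)$. Then for $\rho$-a.e. $x\in G^{-1}(0)$ $$\langle\operatorname{Tr}(\nabla_H^2G)(x)\Phi(x),\Phi(x)\rangle_H=-\langle(\nabla_H\Phi(x))\Phi(x),\operatorname{Tr}(\nabla_HG)(x)\rangle_H ,$$ where $(\nabla_H\Phi(x))k$ is the derivative of $\Phi$ at $x$ in the direction $k\in H$. -/

import Mathlib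

open MeasureTheory ProbabilityTheory Filter Topology
open scoped ENNReal NNReal ContDiff InnerProductSpace

noncomputable section

namespace GaussLevel

section Basic

variable {X : Type*} [NormedAddCommGroup X] [NormedSpace ℝ X] [MeasurableSpace X] [BorelSpace X]

/-- `X*_μ`, the closure of the dual `X*` in `L²(X, μ)`, with the `L²` inner product. The covariance
operator `R_μ` (`GaussLevel.incl` below) is injective on it and its range, with the transported
inner product, is the Cameron–Martin space `H`. So this space is `H`; an element is `ĥ`, and
`incl μ ĥ` is the corresponding point `h` of `X`. -/
abbrev CM (μ : Measure X) : Type _ :=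
  ↥(LinearMap.range (StrongDual.toLp (𝕜 := ℝ) μ 2).toLinearMap).topologicalClosure

/-- `R_μ ĥ = ∫ ĥ(x) x dμ(x)`, the inclusion of the Cameron–Martin space in `X`. -/
def incl (μ : Measure X) (h : CM μ) : X := ∫ x, ((h : Lp ℝ 2 μ) x) • x ∂μ

/-- A centered measure with nondegenerate covariance. -/
def CenteredNondegenerate (μ : Measure X) : Prop :=
  (∀ L : StrongDual ℝ X, ∫ x, L x ∂μ = 0) ∧
    ∀ L : StrongDual ℝ X, L ≠ 0 → 0 < ∫ x, (L x) ^ 2 ∂μ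

/-! ### Cylindrical functions -/

/-- `C_b^k(ℝⁿ)`: the derivatives of orders `0, …, k` exist, are continuous and bounded. -/
def IsCkb {n : ℕ} (k : ℕ∞) (g : (Fin n → ℝ) → ℝ) : Prop :=
  ContDiff ℝ (k : WithTop ℕ∞) g ∧
    ∀ j : ℕ, (j : ℕ∞) ≤ k → ∃ C : ℝ, ∀ y, ‖iteratedFDeriv ℝ j g y‖ ≤ C

/-- `FC_b^k(X)`. -/
def IsCyl (k : ℕ∞) (f : X → ℝ) : Prop :=
  ∃ (n : ℕ) (L : Fin n → StrongDual ℝ X) (g : (Fin n → ℝ) → ℝ),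
    IsCkb k g ∧ f = fun x => g (fun i => L i x)

/-! ### The Hausdorff–Gauss surface measure of Feyel and de La Pradelle -/

/-- The `k`-dimensional spherical Hausdorff measure: `k`-dimensional premeasure
`ω_k r^k` on balls of radius `r`, where `ω_k` is the volume of the unit ball of `ℝ^k`;
sets that are not balls are not used in coverings. -/
def sphericalHausdorff (k : ℕ) (F : Type*) [MetricSpace F] [MeasurableSpace F] [BorelSpace F] :
    Measure F :=
  Measure.mkMetric' fun s : Set F =>
    ⨅ (c : F) (r : ℝ) (_ : 0 < r) (_ : s = Metric.closedBall c r),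
      ENNReal.ofReal (Real.pi ^ ((k : ℝ) / 2) / Real.Gamma ((k : ℝ) / 2 + 1) * r ^ k)

/-- The upper integral of a function, equal to `∫⁻` if the function is `μ`-measurable. -/
def upperLIntegral (μ : Measure X) (f : X → ℝ≥0∞) : ℝ≥0∞ :=
  ⨅ (g : X → ℝ≥0∞) (_ : Measurable g) (_ : ∀ x, f x ≤ g x), ∫⁻ x, g x ∂μ

/-- `∫ f dθ_F` on the slice `(x - π_F x) + F`, where `F` is the span in `H` of the orthonormal
family `u`, identified with `ℝ^(m+1)`, `π_F x = ∑ û_i(x) u_i` is the measurable projection onto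
`F`, and `θ_F` is the `m`-dimensional spherical Hausdorff measure with density
`(2π)^(-(m+1)/2) exp(-|z|²/2)`. -/
def sliceIntegral (μ : Measure X) {m : ℕ} (u : Fin (m + 1) → CM μ) (f : X → ℝ≥0∞) (x : X) :
    ℝ≥0∞ :=
  ∫⁻ z : EuclideanSpace ℝ (Fin (m + 1)),
    f (x - (∑ i, ((u i : Lp ℝ 2 μ) x) • incl μ (u i)) + ∑ i, z i • incl μ (u i)) *
      ENNReal.ofReal ((2 * Real.pi) ^ (-((m + 1 : ℕ) : ℝ) / 2) * Real.exp (-‖z‖ ^ 2 / 2))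
    ∂(sphericalHausdorff m (EuclideanSpace ℝ (Fin (m + 1))))

/-- `∫ f dρ = sup_F ∫ f dρ^F`, where `F` ranges over the finite-dimensional subspaces of `H`
of positive dimension and `∫ f dρ^F = ∫ (∫ f dθ_F) dμ` is the iterated integral over the slices
parallel to `F`. For Borel `f` the slice integral is `μ`-measurable, so that the upper integral
is the integral. -/
def rhoIntegral (μ : Measure X) (f : X → ℝ≥0∞) : ℝ≥0∞ :=
  ⨆ (m : ℕ) (u : Fin (m + 1) → CM μ) (_ : Orthonormal ℝ u),
    upperLIntegral μ (sliceIntegral μ u f)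

/-- The surface measure `ρ` of a (Borel) set. -/
def rho (μ : Measure X) (A : Set X) : ℝ≥0∞ := rhoIntegral μ (A.indicator fun _ => 1)

/-- `P x` for `ρ`-a.e. `x ∈ S`. -/
def RhoAE (μ : Measure X) (S : Set X) (P : X → Prop) : Prop :=
  ∃ N : Set X, MeasurableSet N ∧ rho μ N = 0 ∧ ∀ x ∈ S, x ∉ N → P x

/-! ### Capacities -/

/-- The Ornstein–Uhlenbeck semigroup. -/
def ou (μ : Measure X) (t : ℝ) (f : X → ℝ) (x : X) : ℝ :=
  ∫ y, f (Real.exp (-t) • x + Real.sqrt (1 - Real.exp (-2 * t)) • y) ∂μ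

/-- `(I - L)^(-k/2) f = Γ(k/2)⁻¹ ∫₀^∞ t^(k/2 - 1) e^(-t) T(t)f dt`, where `L` is the generator
of the Ornstein–Uhlenbeck semigroup `T(t)`. -/
def ouPotential (μ : Measure X) (k : ℕ) (f : X → ℝ) (x : X) : ℝ :=
  (Real.Gamma ((k : ℝ) / 2))⁻¹ *
    ∫ t in Set.Ioi (0 : ℝ), t ^ ((k : ℝ) / 2 - 1) * Real.exp (-t) * ou μ t f x

/-- The capacity `C_{k,p}` of an open set. -/
def capOpen (μ : Measure X) (k : ℕ) (p : ℝ) (A : Set X) : ℝ≥0∞ :=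
  ⨅ (f : X → ℝ) (_ : MemLp f (ENNReal.ofReal p) μ)
    (_ : ∀ᵐ x ∂μ, x ∈ A → 1 ≤ ouPotential μ k f x), eLpNorm f (ENNReal.ofReal p) μ

/-! ### Hilbert–Schmidt tensors, Sobolev spaces and precise versions

A Hilbert–Schmidt tensor of order `j` on `H` is given by its coefficients
`(Fin j → ι) → ℝ` in an orthonormal basis `e` of `H`, its norm being the `ℓ²` norm. -/

/-- The `ℓ²` norm of a family of coefficients. -/
def l2norm {α : Type*} (a : α → ℝ) : ℝ≥0∞ := (∑' s, ENNReal.ofReal (a s ^ 2)) ^ (1 / 2 : ℝ)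

variable {ι : Type*} {μ : Measure X}

/-- The coefficients of `∇_H^j f (x)` for a smooth `f`. -/
def hPartial (e : HilbertBasis ι ℝ (CM μ)) (f : X → ℝ) (j : ℕ) (x : X) (s : Fin j → ι) : ℝ :=
  iteratedFDeriv ℝ j f x fun a => incl μ (e (s a))

/-- `D 0` is (a Borel version of) a function of `W^{k,p}(Ω, μ)` and `D 1, …, D k` are its
derivatives along `H`: there is a sequence of functions in `FC_b^∞` which converges, with its
derivatives, to `D 0, …, D k` in `L^p(Ω, μ)`. -/
def IsSobolev (e : HilbertBasis ι ℝ (CM μ)) (Ω : Set X) (k : ℕ) (p : ℝ)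
    (D : (j : ℕ) → X → (Fin j → ι) → ℝ) : Prop :=
  (∀ j ≤ k, ∀ s, Measurable fun x => D j x s) ∧
    ∃ f : ℕ → X → ℝ, (∀ n, IsCyl ⊤ (f n)) ∧
      ∀ j ≤ k, Tendsto
        (fun n => ∫⁻ x in Ω, l2norm (fun s => D j x s - hPartial e (f n) j x s) ^ p ∂μ)
        atTop (𝓝 0)

/-- Borel measurable and `C_{k,p}`-quasicontinuous. -/
def IsPrecise (μ : Measure X) {α : Type*} (k : ℕ) (p : ℝ) (a : X → α → ℝ) : Prop :=
  (∀ s, Measurable fun x => a x s) ∧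
    ∀ ε : ℝ≥0∞, 0 < ε → ∃ A : Set X, IsOpen A ∧ capOpen μ k p A ≤ ε ∧
      ∀ x ∈ Aᶜ, Tendsto (fun y => l2norm (fun s => a y s - a x s)) (𝓝[Aᶜ] x) (𝓝 0)

/-- A function as a tensor field of order `0`. -/
def coeff₀ (ι : Type*) (f : X → ℝ) : X → (Fin 0 → ι) → ℝ := fun x _ => f x

/-- The coefficients of an `H`-valued function. -/
def coeff₁ (e : HilbertBasis ι ℝ (CM μ)) (F : X → CM μ) : X → (Fin 1 → ι) → ℝ :=
  fun x s => ⟪F x, e (s 0)⟫_ℝ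

/-- The coefficients of an operator-valued function. -/
def coeff₂ (e : HilbertBasis ι ℝ (CM μ)) (A : X → CM μ →L[ℝ] CM μ) : X → (Fin 2 → ι) → ℝ :=
  fun x s => ⟪A x (e (s 0)), e (s 1)⟫_ℝ

/-! ### Differentiability along `H` -/

/-- `F (x + t h) = F x + t (A h) + o(t)` as `t → 0`, uniformly for `h ∈ H` of norm `1`. -/
def HasHDerivAt {E : Type*} [NormedAddCommGroup E] [NormedSpace ℝ E] (F : X → E)
    (A : CM μ →L[ℝ] E) (x : X) : Prop :=
  TendstoUniformlyOn (fun (t : ℝ) (h : CM μ) => t⁻¹ • (F (x + t • incl μ h) - F x))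
    (fun h => A h) (𝓝[≠] 0) (Metric.sphere 0 1)

/-! ### The hypotheses on the domain `Ω = {G ≤ 0}` -/

/-- The standing hypotheses on `G`, with the fixed versions `DG` of `∇_H G` and `D2G` of
`∇_H² G`. -/
structure DomainHyp (e : HilbertBasis ι ℝ (CM μ)) (G : X → ℝ) (DG : X → CM μ)
    (D2G : X → CM μ →L[ℝ] CM μ) : Prop where
  hilbertSchmidt : ∀ x, l2norm (coeff₂ e D2G x) < ⊤
  sobolev : ∀ q : ℝ, 1 < q → ∃ D : (j : ℕ) → X → (Fin j → ι) → ℝ,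
    IsSobolev e Set.univ 3 q D ∧ D 0 = coeff₀ ι G ∧ D 1 = coeff₁ e DG ∧ D 2 = coeff₂ e D2G
  convex : ConvexOn ℝ Set.univ G
  precise₀ : ∀ q : ℝ, 1 < q → IsPrecise μ 3 q (coeff₀ ι G)
  precise₁ : ∀ q : ℝ, 1 < q → IsPrecise μ 2 q (coeff₁ e DG)
  precise₂ : ∀ q : ℝ, 1 < q → IsPrecise μ 1 q (coeff₂ e D2G)
  measure_pos : 0 < μ {x | G x ≤ 0}
  isClosed : IsClosed {x | G x ≤ 0}
  integrable_inv : ∀ q : ℝ, 1 < q → ∫⁻ x in {x | G x ≤ 0}, (‖DG x‖ₑ⁻¹) ^ q ∂μ < ⊤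
  twiceDifferentiable : RhoAE μ (G ⁻¹' {0}) fun x =>
    HasHDerivAt G (innerSL ℝ (DG x)) x ∧ HasHDerivAt DG (D2G x) x
  nonzero : RhoAE μ (G ⁻¹' {0}) fun x => DG x ≠ 0

/-! ### Traces -/

/-- `T` is (a Borel version of) the trace on `G⁻¹(0)` of the function `φ ∈ W^{1,p}(Ω, μ)`,
`Ω = {G ≤ 0}`: the limit in `L¹(G⁻¹(0), ρ)` of a sequence `ψ n` of bounded Lipschitz functions on
`Ω` which converges to `φ` in `W^{1,p}(Ω, μ)`. -/
def IsTrace (e : HilbertBasis ι ℝ (CM μ)) (G : X → ℝ) (p : ℝ) (φ T : X → ℝ) : Prop :=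
  Measurable T ∧
  ∃ (D : (j : ℕ) → X → (Fin j → ι) → ℝ) (ψ : ℕ → X → ℝ)
    (Dψ : ℕ → (j : ℕ) → X → (Fin j → ι) → ℝ),
    IsSobolev e {x | G x ≤ 0} 1 p D ∧ D 0 = coeff₀ ι φ ∧
    (∀ n, (∃ K : ℝ≥0, LipschitzOnWith K (ψ n) {x | G x ≤ 0}) ∧
      (∃ C : ℝ, ∀ x, G x ≤ 0 → |ψ n x| ≤ C) ∧
      IsSobolev e {x | G x ≤ 0} 1 p (Dψ n) ∧ Dψ n 0 = coeff₀ ι (ψ n)) ∧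
    (∀ j ≤ 1, Tendsto
      (fun n => ∫⁻ x in {x | G x ≤ 0}, l2norm (fun s => D j x s - Dψ n j x s) ^ p ∂μ)
      atTop (𝓝 0)) ∧
    Tendsto (fun n => rhoIntegral μ ((G ⁻¹' {0}).indicator fun x => ‖ψ n x - T x‖ₑ))
      atTop (𝓝 0)

/-- The trace of an `H`-valued function, taken componentwise. -/
def IsVectorTrace (e : HilbertBasis ι ℝ (CM μ)) (G : X → ℝ) (p : ℝ) (F T : X → CM μ) : Prop :=
  ∀ i, IsTrace e G p (fun x => ⟪F x, e i⟫_ℝ) (fun x => ⟪T x, e i⟫_ℝ)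

/-- The trace of an operator-valued function, taken componentwise. -/
def IsOperatorTrace (e : HilbertBasis ι ℝ (CM μ)) (G : X → ℝ) (p : ℝ)
    (A T : X → CM μ →L[ℝ] CM μ) : Prop :=
  ∀ i j, IsTrace e G p (fun x => ⟪A x (e j), e i⟫_ℝ) (fun x => ⟪T x (e j), e i⟫_ℝ)

/-! ### Tangential fields -/

/-- `Φ ∈ Z(Ω, H)`, where `TDG` is the trace of `∇_H G`. The coefficients of a field in `Z(Ω, H)`
are restrictions to `Ω` of functions in `FC_b²(X)`; here `Φ` is the field given by such
functions on the whole of `X`, so that only its values on `Ω ⊇ G⁻¹(0)` matter below. -/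
def MemZ (G : X → ℝ) (TDG Φ : X → CM μ) : Prop :=
  (∃ (n : ℕ) (h : Fin n → CM μ) (φ : Fin n → X → ℝ),
    (∀ i, IsCyl 2 (φ i)) ∧ Φ = fun x => ∑ i, φ i x • h i) ∧
  RhoAE μ (G ⁻¹' {0}) fun x => ⟪Φ x, TDG x⟫_ℝ = 0

/-- `(∇_H Φ(x)) k`, the derivative of a smooth field `Φ` at `x` in the direction `k ∈ H`. -/
def hDeriv (Φ : X → CM μ) (x : X) (k : CM μ) : CM μ := fderiv ℝ Φ x (incl μ k)

end Basic

end GaussLevel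

end

/-!
Let `u` be a direction of the Cameron–Martin space. A property of lines parallel to `u` which holds
for `μ`-almost every line holds for the lines through `ρ`-almost every `y ∈ G⁻¹(0)` with
`⟨∇G y, u⟩ > 0`: by convexity `∇G y` is a subgradient, so in finite-dimensional slices these points
form countably many Lipschitz graphs over hyperplanes transversal to `u`, and null sets of lines
cut such graphs in null sets.

A Sobolev function is absolutely continuous on almost every line, and its trace is the value at the
end of the segment of the line in `{G ≤ 0}`. Hence `Tr (∇G) = ∇G` and `Tr (∇²G) = ∇²G` hold
`ρ`-almost everywhere. The tangential field `Φ` has values in a finite-dimensional space, so near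
`ρ`-almost every `y` the relation `⟨Φ, ∇G⟩ = 0` holds on points of `G⁻¹(0)` that lie on a dense set
of transversal lines; `Φ y` is tangent to this set, and differentiating the relation along it in
the direction `Φ y` gives `⟨∇²G Φ, Φ⟩ + ⟨∇G, (∇Φ) Φ⟩ = 0`.
-/

noncomputable section

namespace GaussLevel

/-! ### The Cameron–Martin space -/

section CameronMartin

variable {X : Type*} [NormedAddCommGroup X] [NormedSpace ℝ X] [CompleteSpace X]
  [SecondCountableTopology X] [MeasurableSpace X] [BorelSpace X] {μ : Measure X} [IsGaussian μ]

theorem integrable_smul_id (f : Lp ℝ 2 μ) : Integrable (fun x => f x • x) μ :=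
  memLp_one_iff_integrable.1 ((IsGaussian.memLp_two_id (μ := μ)).smul (r := 1) (Lp.memLp f))

/-- The element of the Cameron–Martin space represented by a continuous linear functional. -/
def CM.ofDual (μ : Measure X) (L : StrongDual ℝ X) : CM μ :=
  ⟨StrongDual.toLp μ 2 L, Submodule.le_topologicalClosure _ ⟨L, rfl⟩⟩

theorem CM.coeFn_ofDual (L : StrongDual ℝ X) : (CM.ofDual μ L : Lp ℝ 2 μ) =ᵐ[μ] L := by
  have hid : MemLp (id : X → X) 2 μ := IsGaussian.memLp_two_id
  change StrongDual.toLp μ 2 L =ᵐ[μ] L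
  rw [StrongDual.toLp_apply hid]
  exact MemLp.coeFn_toLp (hid.continuousLinearMap_comp L)

theorem dual_incl (L : StrongDual ℝ X) (h : CM μ) : L (incl μ h) = ⟪h, CM.ofDual μ L⟫_ℝ := by
  rw [incl, ← L.integral_comp_comm (integrable_smul_id _), Submodule.coe_inner, L2.inner_def]
  refine integral_congr_ae ?_
  filter_upwards [CM.coeFn_ofDual L] with x hx
  rw [hx, map_smul, smul_eq_mul, RCLike.inner_apply, conj_trivial, mul_comm]

theorem norm_incl_le (h : CM μ) : ‖incl μ h‖ ≤ ‖StrongDual.toLp (𝕜 := ℝ) μ 2‖ * ‖h‖ := by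
  refine NormedSpace.norm_le_dual_bound ℝ _ (by positivity) fun L => ?_
  calc ‖L (incl μ h)‖ ≤ ‖h‖ * ‖CM.ofDual μ L‖ := dual_incl L h ▸ norm_inner_le_norm _ _
    _ ≤ ‖h‖ * (‖StrongDual.toLp (𝕜 := ℝ) μ 2‖ * ‖L‖) := by
        gcongr
        exact (StrongDual.toLp (𝕜 := ℝ) μ 2).le_opNorm L
    _ = _ := by ring

/-- The inclusion `incl μ` of the Cameron–Martin space as a continuous linear map. -/
def inclCLM (μ : Measure X) [IsGaussian μ] : CM μ →L[ℝ] X :=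
  LinearMap.mkContinuous
    { toFun := incl μ
      map_add' := fun f g => by
        rw [incl, incl, incl, ← integral_add (integrable_smul_id _) (integrable_smul_id _)]
        refine integral_congr_ae ?_
        filter_upwards [Lp.coeFn_add (f : Lp ℝ 2 μ) (g : Lp ℝ 2 μ)] with x hx
        rw [Submodule.coe_add, hx, Pi.add_apply, add_smul]
      map_smul' := fun c f => by
        rw [incl, incl, RingHom.id_apply, ← integral_smul]
        refine integral_congr_ae ?_
        filter_upwards [Lp.coeFn_smul c (f : Lp ℝ 2 μ)] with x hx
        rw [Submodule.coe_smul, hx, Pi.smul_apply, smul_eq_mul, mul_smul] }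
    ‖StrongDual.toLp (𝕜 := ℝ) μ 2‖ norm_incl_le

theorem incl_add (f g : CM μ) : incl μ (f + g) = incl μ f + incl μ g := (inclCLM μ).map_add f g

theorem incl_sub (f g : CM μ) : incl μ (f - g) = incl μ f - incl μ g := (inclCLM μ).map_sub f g

theorem incl_neg (f : CM μ) : incl μ (-f) = -incl μ f := (inclCLM μ).map_neg f

theorem incl_zero : incl μ (0 : CM μ) = 0 := (inclCLM μ).map_zero

theorem incl_smul (c : ℝ) (f : CM μ) : incl μ (c • f) = c • incl μ f := (inclCLM μ).map_smul c f

theorem incl_sum {κ : Type*} (s : Finset κ) (f : κ → CM μ) :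
    incl μ (∑ i ∈ s, f i) = ∑ i ∈ s, incl μ (f i) :=
  map_sum (inclCLM μ) f s

theorem continuous_incl : Continuous (incl μ) := (inclCLM μ).continuous

end CameronMartin

/-! ### Disintegration along Cameron–Martin directions -/

theorem norm_exp_mul_I_sub_exp_mul_I_le (a b : ℝ) :
    ‖Complex.exp (a * Complex.I) - Complex.exp (b * Complex.I)‖ ≤ ‖a - b‖ := by
  have h : Complex.exp (a * Complex.I) - Complex.exp (b * Complex.I)
      = Complex.exp (b * Complex.I) * (Complex.exp (Complex.I * ((a - b : ℝ) : ℂ)) - 1) := by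
    rw [mul_sub, ← Complex.exp_add]
    congr 2
    · push_cast; ring
    · ring
  rw [h, norm_mul, Complex.norm_exp_ofReal_mul_I, one_mul]
  exact Real.norm_exp_I_mul_ofReal_sub_one_le

theorem integrable_exp_mul_I {α : Type*} [MeasurableSpace α] {ν : Measure α} [IsFiniteMeasure ν]
    {f : α → ℝ} (hf : AEStronglyMeasurable f ν) :
    Integrable (fun x => Complex.exp (f x * Complex.I)) ν := by
  refine Integrable.of_bound (C := 1) ?_ (Eventually.of_forall fun x => ?_)
  · exact (show Continuous fun a : ℝ => Complex.exp (a * Complex.I) by fun_prop)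
      |>.comp_aestronglyMeasurable hf
  · rw [Complex.norm_exp_ofReal_mul_I]

theorem lipschitzWith_integral_exp_mul_I {α : Type*} [MeasurableSpace α] (ν : Measure α)
    [IsProbabilityMeasure ν] :
    LipschitzWith 1 fun f : Lp ℝ 2 ν => ∫ x, Complex.exp (f x * Complex.I) ∂ν := by
  refine LipschitzWith.of_dist_le_mul fun f g => ?_
  rw [dist_eq_norm, ← integral_sub (integrable_exp_mul_I (Lp.aestronglyMeasurable f))
    (integrable_exp_mul_I (Lp.aestronglyMeasurable g)), NNReal.coe_one, one_mul, dist_eq_norm,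
    Lp.norm_def]
  have hfg : MemLp (fun x => f x - g x) 2 ν := (Lp.memLp f).sub (Lp.memLp g)
  have hint : Integrable (fun x => f x - g x) ν := hfg.integrable (by norm_num)
  calc _ ≤ ∫ x, ‖f x - g x‖ ∂ν :=
        norm_integral_le_of_norm_le hint.norm
          (Eventually.of_forall fun x => norm_exp_mul_I_sub_exp_mul_I_le _ _)
    _ = (eLpNorm (fun x => f x - g x) 1 ν).toReal := by
        rw [eLpNorm_one_eq_lintegral_enorm, integral_norm_eq_lintegral_enorm hint.1]
    _ ≤ (eLpNorm (fun x => f x - g x) 2 ν).toReal :=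
        ENNReal.toReal_mono hfg.2.ne
          (eLpNorm_le_eLpNorm_of_exponent_le (by norm_num) hfg.1)
    _ = _ := congrArg ENNReal.toReal (eLpNorm_congr_ae (Lp.coeFn_sub f g).symm)

/-- The mean functional of `μ` vanishes: the Gaussian measure is centered. -/
def IsCentered {X : Type*} [NormedAddCommGroup X] [NormedSpace ℝ X] [MeasurableSpace X]
    (μ : Measure X) : Prop :=
  ∀ L : StrongDual ℝ X, ∫ x, L x ∂μ = 0

/-- `(ℓ, v)` disintegrates `μ` along the lines parallel to `h`: moving the point `x - ℓ x • h` by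
an independent Gaussian multiple of `h` of variance `v` does not change the law. -/
structure LineDecomp {X : Type*} [NormedAddCommGroup X] [NormedSpace ℝ X] [MeasurableSpace X]
    (μ : Measure X) (h : X) (ℓ : X → ℝ) (v : ℝ≥0) : Prop where
  measurable : Measurable ℓ
  var_ne_zero : v ≠ 0
  map_eq : (μ.prod (gaussianReal 0 v)).map (fun q : X × ℝ => q.1 + (q.2 - ℓ q.1) • h) = μ

section Lines

variable {X : Type*} [NormedAddCommGroup X] [NormedSpace ℝ X] [SecondCountableTopology X]
  [MeasurableSpace X] [BorelSpace X] {μ : Measure X}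

theorem measurable_lineMap {ℓ : X → ℝ} (hℓ : Measurable ℓ) (h : X) :
    Measurable fun q : X × ℝ => q.1 + (q.2 - ℓ q.1) • h := by
  fun_prop

theorem charFunDual_map_lineMap [SFinite μ] {ℓ : X → ℝ} (hℓ : Measurable ℓ) (h : X) (v : ℝ≥0)
    (L : StrongDual ℝ X) :
    charFunDual ((μ.prod (gaussianReal 0 v)).map fun q : X × ℝ => q.1 + (q.2 - ℓ q.1) • h) L =
      (∫ x, Complex.exp ((L x - L h * ℓ x : ℝ) * Complex.I) ∂μ) *
        Complex.exp (-(v * L h ^ 2 : ℝ) / 2) := by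
  have hgauss : ∫ t, Complex.exp (L h * t * Complex.I) ∂gaussianReal 0 v =
      Complex.exp (-(v * L h ^ 2 : ℝ) / 2) := by
    rw [← charFun_apply_real, charFun_gaussianReal]
    congr 1
    push_cast
    ring
  rw [charFunDual_apply, integral_map (measurable_lineMap hℓ h).aemeasurable
    (Measurable.aestronglyMeasurable (by fun_prop)), ← hgauss, ← integral_prod_mul]
  refine integral_congr_ae (Eventually.of_forall fun q => ?_)
  simp only [← Complex.exp_add, map_add, map_smul, smul_eq_mul]
  congr 1
  push_cast
  ring

theorem LineDecomp.ae_ae {h : X} {ℓ : X → ℝ} {v : ℝ≥0} (hd : LineDecomp μ h ℓ v)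
    {P : X → Prop} (hP : ∀ᵐ x ∂μ, P x) : ∀ᵐ x ∂μ, ∀ᵐ t : ℝ, P (x + t • h) := by
  rw [← hd.map_eq] at hP
  filter_upwards [Measure.ae_ae_of_ae_prod
    (ae_of_ae_map (measurable_lineMap hd.measurable h).aemeasurable hP)] with x hx
  have hvol := (gaussianReal_absolutelyContinuous' 0 hd.var_ne_zero).ae_le hx
  filter_upwards [(measurePreserving_add_right volume (ℓ x)).quasiMeasurePreserving.ae hvol]
    with t ht
  simpa using ht

theorem LineDecomp.ae_notMem {h : X} {ℓ : X → ℝ} {v : ℝ≥0} (hd : LineDecomp μ h ℓ v)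
    {D : Set X} (hD : MeasurableSet D) (hnull : ∀ᵐ x ∂μ, ∀ᵐ t : ℝ, x + t • h ∉ D) :
    ∀ᵐ x ∂μ, x ∉ D := by
  have hmap := measurable_lineMap hd.measurable h
  rw [← hd.map_eq, ae_map_iff hmap.aemeasurable hD.compl]
  refine (Measure.ae_prod_iff_ae_ae (hmap hD.compl)).2 ?_
  filter_upwards [hnull] with x hx
  have hvol := (measurePreserving_add_right volume (-ℓ x)).quasiMeasurePreserving.ae hx
  filter_upwards [(gaussianReal_absolutelyContinuous 0 hd.var_ne_zero).ae_le hvol] with t ht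
  simpa [sub_eq_add_neg] using ht

theorem gaussianPDF_le_gaussianPDF {v : ℝ≥0} {t R : ℝ} (h : |t| ≤ |R|) :
    gaussianPDF 0 v R ≤ gaussianPDF 0 v t := by
  rw [gaussianPDF, gaussianPDF, gaussianPDFReal, gaussianPDFReal, sub_zero, sub_zero]
  have hsq : t ^ 2 ≤ R ^ 2 := sq_le_sq.2 h
  gcongr

theorem setLIntegral_Icc_ne_top_of_gaussianReal {v : ℝ≥0} (hv : v ≠ 0) {F : ℝ → ℝ≥0∞}
    (hF : Measurable F) (hfin : ∫⁻ t, F t ∂gaussianReal 0 v ≠ ⊤) (R : ℝ) :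
    ∫⁻ t in Set.Icc (-R) R, F t ≠ ⊤ := by
  intro htop
  refine hfin (top_le_iff.1 ?_)
  rw [← ENNReal.mul_top (gaussianPDF_pos 0 hv R).ne', ← htop,
    gaussianReal_of_var_ne_zero _ hv, lintegral_withDensity_eq_lintegral_mul _
    (measurable_gaussianPDF 0 v) hF, ← lintegral_const_mul _ hF]
  refine (setLIntegral_mono' measurableSet_Icc fun t ht => ?_).trans (setLIntegral_le_lintegral _ _)
  simp only [Pi.mul_apply]
  gcongr
  exact gaussianPDF_le_gaussianPDF ((abs_le.2 ht).trans (le_abs_self R))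

theorem LineDecomp.ae_setLIntegral_ne_top {h : X} {ℓ : X → ℝ} {v : ℝ≥0}
    (hd : LineDecomp μ h ℓ v) {F : X → ℝ≥0∞} (hF : Measurable F) (hfin : ∫⁻ x, F x ∂μ ≠ ⊤) :
    ∀ᵐ x ∂μ, ∀ R : ℝ, ∫⁻ t in Set.Icc (-R) R, F (x + t • h) ≠ ⊤ := by
  have hmap := measurable_lineMap hd.measurable h
  rw [← hd.map_eq, lintegral_map hF hmap,
    lintegral_prod (fun q : X × ℝ => F (q.1 + (q.2 - ℓ q.1) • h)) (hF.comp hmap).aemeasurable]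
    at hfin
  filter_upwards [ae_lt_top (hF.comp hmap).lintegral_prod_right' hfin] with x hx R
  have hFx : Measurable fun t : ℝ => F (x + (t - ℓ x) • h) :=
    (hF.comp hmap).comp (measurable_prodMk_left (x := x))
  refine ne_top_of_le_ne_top (setLIntegral_Icc_ne_top_of_gaussianReal hd.var_ne_zero hFx hx.ne
    (|R| + |ℓ x|)) ?_
  have hshift := (measurePreserving_add_right volume (ℓ x)).setLIntegral_comp_emb
    (measurableEmbedding_addRight (ℓ x)) (fun t => F (x + (t - ℓ x) • h)) (Set.Icc (-R) R)
  simp only [add_sub_cancel_right] at hshift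
  rw [hshift]
  refine lintegral_mono_set ?_
  rintro _ ⟨t, ht, rfl⟩
  exact abs_le.1 ((abs_add_le t (ℓ x)).trans
    (add_le_add_left ((abs_le.2 ht).trans (le_abs_self R)) _))

end Lines

section Gaussian

variable {X : Type*} [NormedAddCommGroup X] [NormedSpace ℝ X] [CompleteSpace X]
  [SecondCountableTopology X] [MeasurableSpace X] [BorelSpace X] {μ : Measure X} [IsGaussian μ]

theorem charFunDual_eq_exp_norm_ofDual (hμ : IsCentered μ) (L : StrongDual ℝ X) :
    charFunDual μ L = Complex.exp (-(‖CM.ofDual μ L‖ ^ 2 : ℝ) / 2) := by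
  have hvar : ‖CM.ofDual μ L‖ ^ 2 = Var[L; μ] := by
    rw [← real_inner_self_eq_norm_sq, Submodule.coe_inner, L2.inner_def,
      variance_of_integral_eq_zero (by fun_prop) (hμ L)]
    refine integral_congr_ae ?_
    filter_upwards [CM.coeFn_ofDual L] with x hx
    rw [hx, real_inner_self_eq_norm_sq, Real.norm_eq_abs, sq_abs]
  rw [IsGaussian.charFunDual_eq (μ := μ) L, integral_complex_ofReal, hμ L, hvar]
  congr 1
  push_cast
  ring

theorem integral_exp_mul_I_CM (hμ : IsCentered μ) (f : CM μ) :
    ∫ x, Complex.exp ((f : Lp ℝ 2 μ) x * Complex.I) ∂μ = Complex.exp (-(‖f‖ ^ 2 : ℝ) / 2) := by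
  let S : Set (Lp ℝ 2 μ) :=
    {f | ∫ x, Complex.exp (f x * Complex.I) ∂μ = Complex.exp (-(‖f‖ ^ 2 : ℝ) / 2)}
  have hclosed : IsClosed S :=
    isClosed_eq (lipschitzWith_integral_exp_mul_I μ).continuous (by fun_prop)
  have hsub : ((LinearMap.range (StrongDual.toLp (𝕜 := ℝ) μ 2).toLinearMap : Submodule ℝ _) :
      Set (Lp ℝ 2 μ)) ⊆ S := by
    rintro _ ⟨L, rfl⟩
    refine Eq.trans ?_ (charFunDual_eq_exp_norm_ofDual hμ L)
    rw [charFunDual_apply]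
    refine integral_congr_ae ?_
    filter_upwards [CM.coeFn_ofDual L] with x hx
    rw [← hx]
    rfl
  exact hclosed.closure_subset_iff.2 hsub f.2

theorem exists_lineDecomp (hμ : IsCentered μ) {u : CM μ} (hu : u ≠ 0) :
    ∃ ℓ v, LineDecomp μ (incl μ u) ℓ v := by
  have hn : ‖u‖ ≠ 0 := norm_ne_zero_iff.2 hu
  let r : ℝ≥0 := (‖u‖₊ ^ 2)⁻¹
  have hr : (r : ℝ) = (‖u‖ ^ 2)⁻¹ := rfl
  let ℓ : X → ℝ := fun x => r * (u : Lp ℝ 2 μ) x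
  have hℓ : Measurable ℓ := (Lp.stronglyMeasurable (u : Lp ℝ 2 μ)).measurable.const_mul _
  have hmap := measurable_lineMap hℓ (incl μ u)
  refine ⟨ℓ, r, hℓ, by simpa [r] using hu, ?_⟩
  have := Measure.isProbabilityMeasure_map (μ := μ.prod (gaussianReal 0 r)) hmap.aemeasurable
  refine Measure.ext_of_charFunDual (funext fun L => ?_)
  set d : ℝ := L (incl μ u)
  set a : CM μ := CM.ofDual μ L
  have hd : d = ⟪u, a⟫_ℝ := dual_incl L u
  have hrep : ∀ᵐ x ∂μ, ((a - (d * r) • u : CM μ) : Lp ℝ 2 μ) x = L x - d * ℓ x := by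
    filter_upwards [CM.coeFn_ofDual L, Lp.coeFn_sub (a : Lp ℝ 2 μ) (((d * r) • u : CM μ) :),
      Lp.coeFn_smul (d * r) (u : Lp ℝ 2 μ)] with x h1 h2 h3
    rw [Submodule.coe_sub, h2, Pi.sub_apply, h1, Submodule.coe_smul, h3, Pi.smul_apply, smul_eq_mul,
      mul_assoc]
  have hnorm : ‖a - (d * r) • u‖ ^ 2 = ‖a‖ ^ 2 - r * d ^ 2 := by
    have hau : ⟪a, (d * r) • u⟫_ℝ = d * r * d := by
      rw [hd, ← real_inner_comm u a]
      exact real_inner_smul_right a u _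
    rw [norm_sub_sq_real, norm_smul, hau, mul_pow, Real.norm_eq_abs, sq_abs, hr]
    field_simp
    ring
  rw [charFunDual_map_lineMap hℓ, charFunDual_eq_exp_norm_ofDual hμ,
    ← integral_congr_ae (hrep.mono fun x hx => congrArg (fun s : ℝ => Complex.exp (s * _)) hx),
    integral_exp_mul_I_CM hμ, hnorm, ← Complex.exp_add]
  congr 1
  push_cast
  ring

theorem ae_ae_add_smul (hμ : IsCentered μ) (u : CM μ) {P : X → Prop} (hP : ∀ᵐ x ∂μ, P x) :
    ∀ᵐ x ∂μ, ∀ᵐ t : ℝ, P (x + t • incl μ u) := by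
  rcases eq_or_ne u 0 with rfl | hu
  · simpa [incl_zero] using hP
  · obtain ⟨ℓ, v, hd⟩ := exists_lineDecomp hμ hu
    exact hd.ae_ae hP

theorem ae_notMem_of_ae_ae (hμ : IsCentered μ) (u : CM μ) {D : Set X} (hD : MeasurableSet D)
    (hnull : ∀ᵐ x ∂μ, ∀ᵐ t : ℝ, x + t • incl μ u ∉ D) : ∀ᵐ x ∂μ, x ∉ D := by
  rcases eq_or_ne u 0 with rfl | hu
  · simpa [incl_zero] using hnull
  · obtain ⟨ℓ, v, hd⟩ := exists_lineDecomp hμ hu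
    exact hd.ae_notMem hD hnull

theorem ae_setLIntegral_line_ne_top (hμ : IsCentered μ) (u : CM μ) {F : X → ℝ≥0∞}
    (hF : Measurable F) (hfin : ∫⁻ x, F x ∂μ ≠ ⊤) :
    ∀ᵐ x ∂μ, ∀ R : ℝ, ∫⁻ t in Set.Icc (-R) R, F (x + t • incl μ u) ≠ ⊤ := by
  rcases eq_or_ne u 0 with rfl | hu
  · filter_upwards [ae_lt_top hF hfin] with x hx R
    simpa [incl_zero] using ENNReal.mul_ne_top hx.ne ENNReal.ofReal_ne_top
  · obtain ⟨ℓ, v, hd⟩ := exists_lineDecomp hμ hu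
    exact hd.ae_setLIntegral_ne_top hF hfin

theorem ae_add_incl (hμ : IsCentered μ) (h : CM μ) {P : X → Prop} (hP : ∀ᵐ x ∂μ, P x) :
    ∀ᵐ x ∂μ, P (x + incl μ h) := by
  obtain ⟨D, hsub, hD, hD0⟩ := exists_measurable_superset_of_null hP
  have hnull : ∀ᵐ x ∂μ, x ∉ (fun x : X => x + incl μ h) ⁻¹' D := by
    refine ae_notMem_of_ae_ae hμ h ((measurable_add_const _) hD) ?_
    filter_upwards [ae_ae_add_smul hμ h (measure_eq_zero_iff_ae_notMem.1 hD0)] with x hx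
    filter_upwards [(measurePreserving_add_right volume (1 : ℝ)).quasiMeasurePreserving.ae hx]
      with t ht
    simpa [add_smul, add_assoc] using ht
  filter_upwards [hnull] with x hx
  exact not_not.1 fun hP => hx (hsub hP)

theorem ae_ae_add_incl (hμ : IsCentered μ) {Z : Type*} [MeasurableSpace Z] (ν : Measure Z)
    [SFinite ν] {a : Z → CM μ} (ha : Measurable fun z => incl μ (a z)) {P : X → Prop}
    (hP : ∀ᵐ x ∂μ, P x) : ∀ᵐ x ∂μ, ∀ᵐ z ∂ν, P (x + incl μ (a z)) := by
  obtain ⟨D, hsub, hD, hD0⟩ := exists_measurable_superset_of_null hP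
  have hmeas : MeasurableSet {q : Z × X | q.2 + incl μ (a q.1) ∉ D} :=
    (measurable_snd.add (ha.comp measurable_fst)) hD.compl
  have hzx : ∀ᵐ z ∂ν, ∀ᵐ x ∂μ, x + incl μ (a z) ∉ D :=
    Eventually.of_forall fun z => ae_add_incl hμ (a z) (measure_eq_zero_iff_ae_notMem.1 hD0)
  filter_upwards [(Measure.ae_ae_comm hmeas).1 hzx] with x hx
  filter_upwards [hx] with z hz
  exact not_not.1 fun hP => hz (hsub hP)

end Gaussian

/-! ### Null sets of the spherical Hausdorff measure -/

section SphericalHausdorff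

variable {F : Type*} [MetricSpace F]

/-- The volume `ω_k` of the unit ball of `ℝ^k`. -/
def unitBallVolume (k : ℕ) : ℝ := Real.pi ^ ((k : ℝ) / 2) / Real.Gamma ((k : ℝ) / 2 + 1)

theorem unitBallVolume_nonneg (k : ℕ) : 0 ≤ unitBallVolume k :=
  div_nonneg (by positivity) (Real.Gamma_pos_of_pos (by positivity)).le

/-- The gauge of `sphericalHausdorff`: `ω_k r^k` on a ball of radius `r`, and `⊤` on the sets that
are not balls. -/
def ballGauge (k : ℕ) (s : Set F) : ℝ≥0∞ :=
  ⨅ (c : F) (r : ℝ) (_ : 0 < r) (_ : s = Metric.closedBall c r),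
    ENNReal.ofReal (unitBallVolume k * r ^ k)

theorem one_le_ballGauge_zero (s : Set F) : 1 ≤ ballGauge 0 s :=
  le_iInf fun c => le_iInf fun r => le_iInf fun _ => le_iInf fun _ => by simp [unitBallVolume]

theorem ballGauge_pre_closedBall_le (k : ℕ) (c : F) {r δ : ℝ} (hr : 0 < r) (hδ : 2 * r ≤ δ) :
    OuterMeasure.mkMetric'.pre (ballGauge k) (ENNReal.ofReal δ) (Metric.closedBall c r) ≤
      ENNReal.ofReal (unitBallVolume k * r ^ k) := by
  refine (OuterMeasure.mkMetric'.pre_le ?_).trans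
    (iInf₂_le_of_le c r ((iInf_le _ hr).trans (iInf_le _ rfl)))
  rw [← Metric.closedEBall_ofReal hr.le]
  refine Metric.ediam_closedEBall_le.trans ?_
  rw [← ENNReal.ofReal_ofNat, ← ENNReal.ofReal_mul (by norm_num)]
  exact ENNReal.ofReal_le_ofReal hδ

theorem exists_add_pow_le (k : ℕ) (d : ℝ) {ε η : ℝ} (hε : 0 < ε) (hη : 0 < η) :
    ∃ δ, 0 < δ ∧ δ ≤ ε ∧ (d + δ) ^ k ≤ d ^ k + η := by
  have hcont : Tendsto (fun δ : ℝ => (d + δ) ^ k) (𝓝[>] 0) (𝓝 ((d + 0) ^ k)) :=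
    (Continuous.tendsto (by fun_prop) 0).mono_left nhdsWithin_le_nhds
  rw [add_zero] at hcont
  obtain ⟨δ, hpow, hδ⟩ := ((hcont.eventually_lt_const (lt_add_of_pos_right _ hη)).and
    (Ioc_mem_nhdsGT hε)).exists
  exact ⟨δ, hδ.1, hδ.2, hpow.le⟩

variable [MeasurableSpace F] [BorelSpace F]

theorem sphericalHausdorff_eq_mkMetric' (k : ℕ) :
    sphericalHausdorff k F = Measure.mkMetric' (ballGauge k) := rfl

theorem sphericalHausdorff_zero_ne_zero {A : Set F} (hA : A.Nonempty) :
    sphericalHausdorff 0 F A ≠ 0 := by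
  obtain ⟨z, hz⟩ := hA
  have hdirac : OuterMeasure.dirac z ≤ OuterMeasure.mkMetric' (ballGauge (F := F) 0) := by
    refine le_iSup₂_of_le (1 : ℝ≥0∞) one_pos (OuterMeasure.mkMetric'.le_pre.2 fun s _ => ?_)
    rw [OuterMeasure.dirac_apply]
    exact (Set.indicator_le_self' (fun _ _ => zero_le) z).trans (one_le_ballGauge_zero s)
  refine (one_pos.trans_le ?_).ne'
  calc (1 : ℝ≥0∞) = OuterMeasure.dirac z A := by simp [OuterMeasure.dirac_apply, hz]
    _ ≤ _ := hdirac A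
    _ ≤ sphericalHausdorff 0 F A := by
      rw [sphericalHausdorff_eq_mkMetric']
      exact le_toMeasure_apply _ _ _

theorem exists_measurable_superset_ballGauge_pre_le (k : ℕ) {s : Set F} {ε η : ℝ} (hε : 0 < ε)
    (hη : 0 < η) (hs : Metric.ediam s ≤ ENNReal.ofReal ε) :
    ∃ B : Set F, MeasurableSet B ∧ s ⊆ B ∧
      OuterMeasure.mkMetric'.pre (ballGauge k) (ENNReal.ofReal (4 * ε)) B ≤
        ENNReal.ofReal (unitBallVolume k) *
          ((⨆ _ : s.Nonempty, Metric.ediam s ^ (k : ℝ)) + ENNReal.ofReal η) := by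
  rcases s.eq_empty_or_nonempty with rfl | ⟨c, hc⟩
  · exact ⟨∅, MeasurableSet.empty, subset_rfl, by simp⟩
  have hfin : Metric.ediam s ≠ ⊤ := (hs.trans_lt ENNReal.ofReal_lt_top).ne
  set d := (Metric.ediam s).toReal with hd
  have hd0 : 0 ≤ d := ENNReal.toReal_nonneg
  have hdε : d ≤ ε := ENNReal.toReal_le_of_le_ofReal hε.le hs
  obtain ⟨δ, hδ0, hδε, hpow⟩ := exists_add_pow_le k d hε hη
  refine ⟨Metric.closedBall c (d + δ), measurableSet_closedBall, fun y hy => ?_, ?_⟩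
  · have hyc : dist y c ≤ d := by
      rw [hd, dist_edist]
      exact ENNReal.toReal_mono hfin (Metric.edist_le_ediam_of_mem hy hc)
    exact Metric.mem_closedBall.2 (by linarith)
  · refine (ballGauge_pre_closedBall_le k c (by positivity) (by linarith)).trans ?_
    rw [ENNReal.ofReal_mul (unitBallVolume_nonneg k), ciSup_pos ⟨c, hc⟩]
    gcongr
    refine (ENNReal.ofReal_le_ofReal hpow).trans_eq ?_
    rw [ENNReal.ofReal_add (by positivity) hη.le, ENNReal.ofReal_pow hd0, hd,
      ENNReal.ofReal_toReal hfin, ENNReal.rpow_natCast]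

theorem exists_measurable_superset_of_hausdorffMeasure_eq_zero {k : ℕ} {Z : Set F}
    (hZ : μH[(k : ℝ)] Z = 0) {ε : ℝ} (hε : 0 < ε) :
    ∃ U : Set F, MeasurableSet U ∧ Z ⊆ U ∧
      OuterMeasure.mkMetric'.pre (ballGauge k) (ENNReal.ofReal (4 * ε)) U ≤
        ENNReal.ofReal (unitBallVolume k) * (2 * ENNReal.ofReal ε) := by
  have hε' : 0 < ENNReal.ofReal ε := ENNReal.ofReal_pos.2 hε
  have hinf : (⨅ (t : ℕ → Set F) (_ : Z ⊆ ⋃ n, t n)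
      (_ : ∀ n, Metric.ediam (t n) ≤ ENNReal.ofReal ε),
      ∑' n, ⨆ _ : (t n).Nonempty, Metric.ediam (t n) ^ (k : ℝ)) < ENNReal.ofReal ε := by
    refine lt_of_le_of_lt ?_ hε'
    rw [← hZ, Measure.hausdorffMeasure_apply]
    exact le_iSup₂ (f := fun (r : ℝ≥0∞) (_ : 0 < r) =>
      ⨅ (t : ℕ → Set F) (_ : Z ⊆ ⋃ n, t n) (_ : ∀ n, Metric.ediam (t n) ≤ r),
          ∑' n, ⨆ _ : (t n).Nonempty, Metric.ediam (t n) ^ (k : ℝ)) _ hε'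
  simp only [iInf_lt_iff] at hinf
  obtain ⟨t, hcov, hdiam, hsum⟩ := hinf
  obtain ⟨η, hη0, hηsum⟩ := ENNReal.exists_pos_sum_of_countable hε'.ne' ℕ
  choose B hBm htB hB using fun n => exists_measurable_superset_ballGauge_pre_le k hε
    (NNReal.coe_pos.2 (hη0 n)) (hdiam n)
  refine ⟨⋃ n, B n, MeasurableSet.iUnion hBm, hcov.trans (Set.iUnion_mono htB), ?_⟩
  refine (measure_iUnion_le B).trans ((ENNReal.tsum_le_tsum hB).trans ?_)
  simp only [ENNReal.ofReal_coe_nnreal]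
  rw [ENNReal.tsum_mul_left, ENNReal.tsum_add, two_mul]
  gcongr

theorem sphericalHausdorff_eq_zero {k : ℕ} {Z : Set F} (hZ : μH[(k : ℝ)] Z = 0) :
    sphericalHausdorff k F Z = 0 := by
  have hpos : ∀ n : ℕ, (0 : ℝ) < 1 / ((n : ℝ) + 1) := fun n => by positivity
  choose U hUm hZU hU using fun n : ℕ =>
    exists_measurable_superset_of_hausdorffMeasure_eq_zero hZ (hpos n)
  refine measure_mono_null (Set.subset_iInter hZU) ?_
  rw [sphericalHausdorff_eq_mkMetric', Measure.mkMetric',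
    toMeasure_apply _ _ (MeasurableSet.iInter hUm), OuterMeasure.mkMetric', ← nonpos_iff_eq_zero]
  simp only [OuterMeasure.iSup_apply, iSup_le_iff]
  intro r hr
  have hinv : Tendsto (fun n : ℕ => (1 : ℝ) / ((n : ℝ) + 1)) atTop (𝓝 0) :=
    tendsto_one_div_add_atTop_nhds_zero_nat
  have hradius : Tendsto (fun n : ℕ => ENNReal.ofReal (4 * (1 / ((n : ℝ) + 1)))) atTop (𝓝 0) := by
    simpa only [mul_zero, ENNReal.ofReal_zero] using ENNReal.tendsto_ofReal (hinv.const_mul 4)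
  have hbound : Tendsto (fun n : ℕ => ENNReal.ofReal (unitBallVolume k) *
      (2 * ENNReal.ofReal (1 / ((n : ℝ) + 1)))) atTop (𝓝 0) := by
    simpa using ENNReal.Tendsto.const_mul (ENNReal.Tendsto.const_mul (a := 2)
      (ENNReal.tendsto_ofReal hinv) (Or.inr (by simp))) (Or.inr ENNReal.ofReal_ne_top)
  refine ge_of_tendsto hbound ?_
  filter_upwards [hradius.eventually_lt_const hr] with n hn
  exact (OuterMeasure.mkMetric'.mono_pre _ hn.le _).trans
    ((measure_mono (Set.iInter_subset _ _)).trans (hU n))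

end SphericalHausdorff

theorem hausdorffMeasure_image_eq_zero {α E E' : Type*} [EMetricSpace E] [MeasurableSpace E]
    [BorelSpace E] [EMetricSpace E'] [MeasurableSpace E'] [BorelSpace E'] {P : Set α}
    {π : α → E} {σ : α → E'} {C : ℝ≥0} {d : ℝ} (hd : 0 ≤ d)
    (h : ∀ p ∈ P, ∀ q ∈ P, edist (σ p) (σ q) ≤ C * edist (π p) (π q))
    (h0 : μH[d] (π '' P) = 0) : μH[d] (σ '' P) = 0 := by
  rcases P.eq_empty_or_nonempty with rfl | ⟨p₀, -⟩
  · simp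
  have : Nonempty α := ⟨p₀⟩
  set g : E → α := Function.invFunOn π P
  have hg : ∀ p ∈ P, g (π p) ∈ P ∧ π (g (π p)) = π p := fun p hp =>
    ⟨Function.invFunOn_mem ⟨p, hp, rfl⟩, Function.invFunOn_eq ⟨p, hp, rfl⟩⟩
  have hlip : LipschitzOnWith C (σ ∘ g) (π '' P) := by
    rintro _ ⟨p, hp, rfl⟩ _ ⟨q, hq, rfl⟩
    have hle := h _ (hg p hp).1 _ (hg q hq).1
    rwa [(hg p hp).2, (hg q hq).2] at hle
  have himage : σ '' P ⊆ (σ ∘ g) '' (π '' P) := by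
    rintro _ ⟨p, hp, rfl⟩
    refine ⟨π p, ⟨p, hp, rfl⟩, ?_⟩
    have hle := h _ (hg p hp).1 p hp
    rwa [(hg p hp).2, edist_self, mul_zero, nonpos_iff_eq_zero, edist_eq_zero] at hle
  refine measure_mono_null himage (nonpos_iff_eq_zero.1 ?_)
  exact (hlip.hausdorffMeasure_image_le hd).trans (by rw [h0, mul_zero])

theorem sphericalHausdorff_graph_eq_zero {m : ℕ} {Z : Set (EuclideanSpace ℝ (Fin (m + 1)))}
    (i : Fin (m + 1)) {C : ℝ≥0}
    (h : ∀ z ∈ Z, ∀ z' ∈ Z, dist z z' ≤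
      C * dist (fun j => z (i.succAbove j)) (fun j => z' (i.succAbove j)))
    (h0 : volume ((fun (z : EuclideanSpace ℝ (Fin (m + 1))) (j : Fin m) =>
      z (i.succAbove j)) '' Z) = 0) :
    sphericalHausdorff m (EuclideanSpace ℝ (Fin (m + 1))) Z = 0 := by
  refine sphericalHausdorff_eq_zero ?_
  have hpi := hausdorffMeasure_pi_real (ι := Fin m)
  rw [Fintype.card_fin] at hpi
  have himage := hausdorffMeasure_image_eq_zero (P := Z) (σ := id) (C := C) (Nat.cast_nonneg m)
    (fun p hp q hq => ?_) (hpi ▸ h0)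
  · rwa [Set.image_id] at himage
  · rw [id, id, edist_dist, edist_dist, ← ENNReal.ofReal_coe_nnreal,
      ← ENNReal.ofReal_mul C.coe_nonneg]
    exact ENNReal.ofReal_le_ofReal (h p hp q hq)

/-! ### Null sets of the Hausdorff–Gauss measure -/

section UpperIntegral

variable {X : Type*} [MeasurableSpace X] {μ : Measure X}

theorem upperLIntegral_le {f g : X → ℝ≥0∞} (hg : Measurable g) (hfg : ∀ x, f x ≤ g x) :
    upperLIntegral μ f ≤ ∫⁻ x, g x ∂μ :=
  iInf_le_of_le g ((iInf_le _ hg).trans (iInf_le _ hfg))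

theorem exists_measurable_majorant {f : X → ℝ≥0∞} (hf : upperLIntegral μ f ≠ ⊤) {ε : ℝ≥0∞}
    (hε : ε ≠ 0) : ∃ g : X → ℝ≥0∞, Measurable g ∧ (∀ x, f x ≤ g x) ∧
      ∫⁻ x, g x ∂μ ≤ upperLIntegral μ f + ε := by
  have h : upperLIntegral μ f < upperLIntegral μ f + ε := ENNReal.lt_add_right hf hε
  conv_lhs at h => rw [upperLIntegral]
  simp only [iInf_lt_iff] at h
  obtain ⟨g, hg, hfg, hlt⟩ := h
  exact ⟨g, hg, hfg, hlt.le⟩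

theorem upperLIntegral_tsum_le (f : ℕ → X → ℝ≥0∞) :
    upperLIntegral μ (fun x => ∑' n, f n x) ≤ ∑' n, upperLIntegral μ (f n) := by
  refine ENNReal.le_of_forall_pos_le_add fun ε hε hfin => ?_
  obtain ⟨η, hη0, hη⟩ := ENNReal.exists_pos_sum_of_countable' (ENNReal.coe_pos.2 hε).ne' ℕ
  choose g hg hfg hle using fun n =>
    exists_measurable_majorant (ENNReal.ne_top_of_tsum_ne_top hfin.ne n) (hη0 n).ne'
  calc upperLIntegral μ (fun x => ∑' n, f n x)
      ≤ ∫⁻ x, ∑' n, g n x ∂μ :=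
        upperLIntegral_le (Measurable.tsum hg) fun x => ENNReal.tsum_le_tsum fun n => hfg n x
    _ = ∑' n, ∫⁻ x, g n x ∂μ := lintegral_tsum fun n => (hg n).aemeasurable
    _ ≤ ∑' n, (upperLIntegral μ (f n) + η n) := ENNReal.tsum_le_tsum hle
    _ ≤ ∑' n, upperLIntegral μ (f n) + ε := by
        rw [ENNReal.tsum_add]
        gcongr

theorem ae_ne_top_of_upperLIntegral_ne_top {f : X → ℝ≥0∞} (hf : upperLIntegral μ f ≠ ⊤) :
    ∀ᵐ x ∂μ, f x ≠ ⊤ := by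
  obtain ⟨g, hg, hfg, hle⟩ := exists_measurable_majorant hf one_ne_zero
  have hfin : ∫⁻ x, g x ∂μ ≠ ⊤ := ne_top_of_le_ne_top (ENNReal.add_ne_top.2 ⟨hf, by simp⟩) hle
  filter_upwards [ae_lt_top hg hfin] with x hx
  exact ((hfg x).trans_lt hx).ne

theorem upperLIntegral_eq_zero_iff {f : X → ℝ≥0∞} :
    upperLIntegral μ f = 0 ↔ ∀ᵐ x ∂μ, f x = 0 := by
  refine ⟨fun h => ?_, fun h => nonpos_iff_eq_zero.1 ?_⟩
  · have hsum : upperLIntegral μ (fun x => ∑' _ : ℕ, f x) ≠ ⊤ :=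
      ne_top_of_le_ne_top (by simp [h]) (upperLIntegral_tsum_le fun _ => f)
    filter_upwards [ae_ne_top_of_upperLIntegral_ne_top hsum] with x hx
    by_contra hc
    exact hx (ENNReal.tsum_const_eq_top_of_ne_zero hc)
  · obtain ⟨N, hsub, hN, hN0⟩ := exists_measurable_superset_of_null (ae_iff.1 h)
    refine (upperLIntegral_le (measurable_const.indicator hN) fun x => ?_).trans_eq
      (lintegral_indicator_const hN ⊤ |>.trans (by rw [hN0, mul_zero]))
    by_cases hx : x ∈ N
    · simp [hx]
    · rw [not_not.1 fun hc => hx (hsub hc)]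
      exact zero_le

end UpperIntegral

section Slices

variable {X : Type*} [NormedAddCommGroup X] [NormedSpace ℝ X] [MeasurableSpace X] [BorelSpace X]
  {μ : Measure X}

/-- The point with coordinates `z` of the slice through `x` parallel to the span of `u`. -/
def slicePt (μ : Measure X) {m : ℕ} (u : Fin (m + 1) → CM μ) (x : X)
    (z : EuclideanSpace ℝ (Fin (m + 1))) : X :=
  x - (∑ i, ((u i : Lp ℝ 2 μ) x) • incl μ (u i)) + ∑ i, z i • incl μ (u i)

theorem measurable_slicePt {m : ℕ} (u : Fin (m + 1) → CM μ) (x : X) :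
    Measurable (slicePt μ u x) := by
  have : Continuous (slicePt μ u x) := by
    unfold slicePt
    fun_prop
  exact this.measurable

/-- The density of `θ_F` with respect to the spherical Hausdorff measure of `F = ℝ^(m+1)`. -/
def sliceDensity (m : ℕ) (z : EuclideanSpace ℝ (Fin (m + 1))) : ℝ≥0∞ :=
  ENNReal.ofReal ((2 * Real.pi) ^ (-((m + 1 : ℕ) : ℝ) / 2) * Real.exp (-‖z‖ ^ 2 / 2))

theorem sliceDensity_ne_zero (m : ℕ) (z : EuclideanSpace ℝ (Fin (m + 1))) :
    sliceDensity m z ≠ 0 :=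
  (ENNReal.ofReal_pos.2 (by positivity)).ne'

theorem measurable_slicePt_mul_sliceDensity {m : ℕ} (u : Fin (m + 1) → CM μ) (x : X)
    {f : X → ℝ≥0∞} (hf : Measurable f) :
    Measurable fun z => f (slicePt μ u x z) * sliceDensity m z := by
  refine (hf.comp (measurable_slicePt u x)).mul ?_
  unfold sliceDensity
  fun_prop

theorem sliceIntegral_eq {m : ℕ} (u : Fin (m + 1) → CM μ) (f : X → ℝ≥0∞) (x : X) :
    sliceIntegral μ u f x = ∫⁻ z, f (slicePt μ u x z) * sliceDensity m z
      ∂(sphericalHausdorff m (EuclideanSpace ℝ (Fin (m + 1)))) := rfl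

theorem sliceIntegral_tsum {m : ℕ} (u : Fin (m + 1) → CM μ) {f : ℕ → X → ℝ≥0∞}
    (hf : ∀ n, Measurable (f n)) (x : X) :
    sliceIntegral μ u (fun y => ∑' n, f n y) x = ∑' n, sliceIntegral μ u (f n) x := by
  simp only [sliceIntegral_eq, ← ENNReal.tsum_mul_right]
  exact lintegral_tsum fun n => (measurable_slicePt_mul_sliceDensity u x (hf n)).aemeasurable

theorem sliceIntegral_indicator_eq_zero_iff {m : ℕ} (u : Fin (m + 1) → CM μ) {N : Set X}
    (hN : MeasurableSet N) (x : X) :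
    sliceIntegral μ u (N.indicator fun _ => 1) x = 0 ↔
      sphericalHausdorff m (EuclideanSpace ℝ (Fin (m + 1))) {z | slicePt μ u x z ∈ N} = 0 := by
  rw [sliceIntegral_eq, lintegral_eq_zero_iff
    (measurable_slicePt_mul_sliceDensity u x (measurable_const.indicator hN)),
    measure_eq_zero_iff_ae_notMem]
  exact eventually_congr (Eventually.of_forall fun z => by simp [sliceDensity_ne_zero])

theorem rho_eq_zero_iff {N : Set X} (hN : MeasurableSet N) :
    rho μ N = 0 ↔ ∀ (m : ℕ) (u : Fin (m + 1) → CM μ), Orthonormal ℝ u → ∀ᵐ x ∂μ,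
      sphericalHausdorff m (EuclideanSpace ℝ (Fin (m + 1))) {z | slicePt μ u x z ∈ N} = 0 := by
  rw [rho, rhoIntegral]
  simp only [ENNReal.iSup_eq_zero, upperLIntegral_eq_zero_iff,
    sliceIntegral_indicator_eq_zero_iff _ hN]

theorem rho_iUnion_eq_zero {N : ℕ → Set X} (hN : ∀ n, MeasurableSet (N n))
    (h : ∀ n, rho μ (N n) = 0) : rho μ (⋃ n, N n) = 0 := by
  rw [rho_eq_zero_iff (MeasurableSet.iUnion hN)]
  intro m u hu
  filter_upwards [ae_all_iff.2 fun n => (rho_eq_zero_iff (hN n)).1 (h n) m u hu] with x hx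
  change sphericalHausdorff m _ (slicePt μ u x ⁻¹' ⋃ n, N n) = 0
  rw [Set.preimage_iUnion]
  exact measure_iUnion_null hx

theorem rhoIntegral_tsum_le {f : ℕ → X → ℝ≥0∞} (hf : ∀ n, Measurable (f n)) :
    rhoIntegral μ (fun x => ∑' n, f n x) ≤ ∑' n, rhoIntegral μ (f n) := by
  refine iSup_le fun m => iSup_le fun u => iSup_le fun hu => ?_
  simp only [funext (sliceIntegral_tsum u hf)]
  exact (upperLIntegral_tsum_le _).trans (ENNReal.tsum_le_tsum fun n =>
    le_iSup_of_le m (le_iSup_of_le u (le_iSup_of_le hu le_rfl)))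

theorem rho_eq_top_eq_zero {f : X → ℝ≥0∞} (hf : Measurable f) (hfin : rhoIntegral μ f ≠ ⊤) :
    rho μ {x | f x = ⊤} = 0 := by
  refine (rho_eq_zero_iff (hf (measurableSet_singleton ⊤))).2 fun m u hu => ?_
  have hslice : upperLIntegral μ (sliceIntegral μ u f) ≠ ⊤ := ne_top_of_le_ne_top hfin
    (le_iSup_of_le m (le_iSup_of_le u (le_iSup_of_le hu le_rfl)))
  filter_upwards [ae_ne_top_of_upperLIntegral_ne_top hslice] with x hx
  rw [measure_eq_zero_iff_ae_notMem]
  filter_upwards [ae_lt_top (measurable_slicePt_mul_sliceDensity u x hf) hx] with z hz hc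
  rw [show f (slicePt μ u x z) = ⊤ from hc, ENNReal.top_mul (sliceDensity_ne_zero m z)] at hz
  exact hz.ne rfl

end Slices

section RhoAE

variable {X : Type*} [NormedAddCommGroup X] [NormedSpace ℝ X] [MeasurableSpace X] [BorelSpace X]
  {μ : Measure X} {S : Set X}

theorem RhoAE.mono {P Q : X → Prop} (h : RhoAE μ S P) (hPQ : ∀ x ∈ S, P x → Q x) :
    RhoAE μ S Q := by
  obtain ⟨N, hN, h0, hP⟩ := h
  exact ⟨N, hN, h0, fun x hx hxN => hPQ x hx (hP x hx hxN)⟩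

theorem RhoAE.forall_nat {P : ℕ → X → Prop} (h : ∀ n, RhoAE μ S (P n)) :
    RhoAE μ S fun x => ∀ n, P n x := by
  choose N hN h0 hP using h
  exact ⟨⋃ n, N n, MeasurableSet.iUnion hN, rho_iUnion_eq_zero hN h0, fun x hx hxN n =>
    hP n x hx fun hc => hxN (Set.mem_iUnion.2 ⟨n, hc⟩)⟩

theorem RhoAE.forall {κ : Type*} [Countable κ] {P : κ → X → Prop} (h : ∀ k, RhoAE μ S (P k)) :
    RhoAE μ S fun x => ∀ k, P k x := by
  obtain ⟨f, hf⟩ := Countable.exists_injective_nat κ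
  have hall : RhoAE μ S fun x => ∀ n : ℕ, ∀ k, f k = n → P k x := by
    refine RhoAE.forall_nat fun n => ?_
    by_cases hn : ∃ k, f k = n
    · obtain ⟨k, rfl⟩ := hn
      exact (h k).mono fun x _ hx k' hk' => hf hk' ▸ hx
    · push Not at hn
      exact ⟨∅, MeasurableSet.empty, (rho_eq_zero_iff MeasurableSet.empty).2 (by simp),
        fun x _ _ k hk => (hn k hk).elim⟩
  exact hall.mono fun x _ hx k => hx _ k rfl

theorem RhoAE.and {P Q : X → Prop} (hP : RhoAE μ S P) (hQ : RhoAE μ S Q) :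
    RhoAE μ S fun x => P x ∧ Q x := by
  have hPQ : RhoAE μ S fun x => ∀ b : Bool, (bif b then P else Q) x :=
    RhoAE.forall (by rintro (_ | _) <;> assumption)
  exact hPQ.mono fun x _ hx => ⟨hx true, hx false⟩

theorem rhoAE_tendsto_zero (hS : MeasurableSet S) {f : ℕ → X → ℝ≥0∞}
    (hf : ∀ n, Measurable (f n)) (hsum : ∑' n, rhoIntegral μ (S.indicator (f n)) ≠ ⊤) :
    RhoAE μ S fun x => Tendsto (fun n => f n x) atTop (𝓝 0) := by
  have hfS : ∀ n, Measurable (S.indicator (f n)) := fun n => (hf n).indicator hS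
  have hm : Measurable fun x => ∑' n, S.indicator (f n) x := Measurable.tsum hfS
  refine ⟨_, hm (measurableSet_singleton ⊤), rho_eq_top_eq_zero hm
    (ne_top_of_le_ne_top hsum (rhoIntegral_tsum_le hfS)), fun x hx hxN => ?_⟩
  refine ENNReal.tendsto_atTop_zero_of_tsum_ne_top fun hc => hxN ?_
  change ∑' n, S.indicator (f n) x = ⊤
  simpa only [Set.indicator_of_mem hx] using hc

theorem RhoAE.ae_line [CompleteSpace X] [SecondCountableTopology X] [IsGaussian μ]
    {P : X → Prop} (h : RhoAE μ S P) {w : CM μ} (hw : w ≠ 0) :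
    ∀ᵐ x ∂μ, ∀ t : ℝ, x + t • incl μ w ∈ S → P (x + t • incl μ w) := by
  -- On the slices parallel to `ℝ w` the measure `θ_F` charges every point.
  obtain ⟨N, hN, h0, hP⟩ := h
  have hn : ‖w‖ ≠ 0 := norm_ne_zero_iff.2 hw
  have ho : Orthonormal ℝ (fun _ : Fin (0 + 1) => ‖w‖⁻¹ • w) := by
    refine ⟨fun _ => ?_, fun _ _ hij => (hij (Subsingleton.elim (α := Fin 1) _ _)).elim⟩
    rw [norm_smul, norm_inv, norm_norm, inv_mul_cancel₀ hn]
  filter_upwards [(rho_eq_zero_iff hN).1 h0 0 _ ho] with x hx t ht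
  refine hP _ ht fun hc => sphericalHausdorff_zero_ne_zero ?_ hx
  refine ⟨WithLp.toLp 2 fun _ => (((‖w‖⁻¹ • w : CM μ) : Lp ℝ 2 μ) x) + t * ‖w‖, ?_⟩
  change slicePt μ _ x _ ∈ N
  convert hc using 1
  simp only [slicePt, Fin.sum_univ_succ, Finset.univ_eq_empty, Finset.sum_empty, add_zero]
  rw [add_smul, incl_smul, smul_smul (t * ‖w‖), mul_assoc, mul_inv_cancel₀ hn, mul_one]
  abel

end RhoAE

/-! ### Subgradients along the Cameron–Martin space -/

theorem continuous_comp_add_linearMap {X E : Type*} [AddCommGroup X] [Module ℝ X]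
    [NormedAddCommGroup E] [NormedSpace ℝ E] [FiniteDimensional ℝ E] {G : X → ℝ}
    (hG : ConvexOn ℝ Set.univ G) (x : X) (T : E →ₗ[ℝ] X) : Continuous fun z => G (x + T z) := by
  have h : ConvexOn ℝ Set.univ fun z => G (x + T z) := by
    simpa [Function.comp_def] using (hG.translate_right x).comp_linearMap T
  exact h.locallyLipschitz.continuous

section Subgradient

variable {X : Type*} [NormedAddCommGroup X] [NormedSpace ℝ X] [MeasurableSpace X] [BorelSpace X]
  {μ : Measure X}

-- `rw` with `real_inner_smul_right` does not see the scalar action of `CM μ`.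
theorem CM.inner_smul_right (a b : CM μ) (c : ℝ) : ⟪a, c • b⟫_ℝ = c * ⟪a, b⟫_ℝ :=
  real_inner_smul_right a b c

theorem CM.inner_smul_left (a b : CM μ) (c : ℝ) : ⟪c • a, b⟫_ℝ = c * ⟪a, b⟫_ℝ :=
  real_inner_smul_left a b c

/-- `DG y` is a subgradient of `G` at `y` along the Cameron–Martin space. -/
def IsSubgradAt (G : X → ℝ) (DG : X → CM μ) (y : X) : Prop :=
  ∀ k : CM μ, G y + ⟪DG y, k⟫_ℝ ≤ G (y + incl μ k)

/-- The points of `{G = 0}` where `DG` is a subgradient bounded by `K` and has slope at least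
`K⁻¹` in the direction `v`. In each plane, this is a piece of a Lipschitz graph along `v`. -/
def steepSet (G : X → ℝ) (DG : X → CM μ) (v : CM μ) (K : ℝ) : Set X :=
  {y | G y = 0 ∧ IsSubgradAt G DG y ∧ 1 ≤ K * ⟪DG y, v⟫_ℝ ∧ ‖DG y‖ ≤ K}

theorem exists_nat_mem_steepSet {G : X → ℝ} {DG : X → CM μ} {v : CM μ} {y : X} (h0 : G y = 0)
    (hsub : IsSubgradAt G DG y) (hv : 0 < ⟪DG y, v⟫_ℝ) : ∃ K : ℕ, y ∈ steepSet G DG v K := by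
  obtain ⟨K, hK⟩ := exists_nat_ge (max (1 / ⟪DG y, v⟫_ℝ) ‖DG y‖)
  exact ⟨K, h0, hsub, (div_le_iff₀ hv).1 ((le_max_left _ _).trans hK), (le_max_right _ _).trans hK⟩

theorem le_of_mem_steepSet {G : X → ℝ} {DG : X → CM μ} {v : CM μ} {K : ℝ} {y : X}
    (hy : y ∈ steepSet G DG v K) {s : ℝ} {w : CM μ}
    (h0 : G (y + incl μ (s • v + w)) = 0) : s ≤ K ^ 2 * ‖w‖ := by
  obtain ⟨hy0, hsub, hslope, hnorm⟩ := hy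
  have hK : 0 ≤ K := (norm_nonneg _).trans hnorm
  rcases le_or_gt s 0 with hs | hs
  · exact hs.trans (by positivity)
  have hle := hsub (s • v + w)
  rw [h0, hy0, zero_add, inner_add_right, CM.inner_smul_right] at hle
  have hw : -⟪DG y, w⟫_ℝ ≤ K * ‖w‖ :=
    (neg_le_abs _).trans ((abs_real_inner_le_norm _ _).trans (by gcongr))
  calc s ≤ s * (K * ⟪DG y, v⟫_ℝ) := le_mul_of_one_le_right hs.le hslope
    _ = K * (s * ⟪DG y, v⟫_ℝ) := by ring
    _ ≤ K * (K * ‖w‖) := mul_le_mul_of_nonneg_left (by linarith) hK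
    _ = K ^ 2 * ‖w‖ := by ring

variable [CompleteSpace X] [SecondCountableTopology X] [IsGaussian μ]

theorem HasHDerivAt.hasFDerivAt {E : Type*} [NormedAddCommGroup E] [NormedSpace ℝ E]
    {F : X → E} {A : CM μ →L[ℝ] E} {x : X} (h : HasHDerivAt F A x) :
    HasFDerivAt (fun k : CM μ => F (x + incl μ k)) A 0 := by
  rw [hasFDerivAt_iff_isLittleO_nhds_zero, Asymptotics.isLittleO_iff]
  intro ε hε
  obtain ⟨δ, hδ, hδε⟩ := Metric.eventually_nhds_iff.1 (eventually_nhdsWithin_iff.1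
    ((Metric.tendstoUniformlyOn_iff.1 h) ε hε))
  refine Metric.eventually_nhds_iff.2 ⟨δ, hδ, fun k hk => ?_⟩
  rw [dist_zero_right] at hk
  simp only [zero_add, incl_zero, add_zero]
  rcases eq_or_ne k 0 with rfl | hk0
  · simp [incl_zero]
  have hn : 0 < ‖k‖ := norm_pos_iff.2 hk0
  have hquot := hδε (y := ‖k‖) (by simpa using hk) hn.ne' (‖k‖⁻¹ • k)
    (by rw [mem_sphere_zero_iff_norm, norm_smul, norm_inv, norm_norm, inv_mul_cancel₀ hn.ne'])
  rw [dist_comm, dist_eq_norm, incl_smul, smul_smul, mul_inv_cancel₀ hn.ne', one_smul,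
    map_smul, ← smul_sub, norm_smul, norm_inv, norm_norm] at hquot
  calc _ = ‖k‖ * (‖k‖⁻¹ * ‖F (x + incl μ k) - F x - A k‖) := by
        rw [← mul_assoc, mul_inv_cancel₀ hn.ne', one_mul]
    _ ≤ ‖k‖ * ε := by gcongr
    _ = ε * ‖k‖ := mul_comm _ _

theorem HasHDerivAt.hasDerivAt {E : Type*} [NormedAddCommGroup E] [NormedSpace ℝ E]
    {F : X → E} {A : CM μ →L[ℝ] E} {x : X} (h : HasHDerivAt F A x) (k : CM μ) :
    HasDerivAt (fun t : ℝ => F (x + t • incl μ k)) (A k) 0 := by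
  have hline : HasDerivAt (fun t : ℝ => t • k) k 0 := by
    simpa using (hasDerivAt_id (0 : ℝ)).smul_const k
  have hcomp := HasFDerivAt.comp_hasDerivAt (f := fun t : ℝ => t • k) (0 : ℝ)
    (by simpa using h.hasFDerivAt) hline
  simpa only [Function.comp_def, incl_smul] using hcomp

theorem HasHDerivAt.isSubgradAt {G : X → ℝ} (hG : ConvexOn ℝ Set.univ G) {DG : X → CM μ}
    {y : X} (h : HasHDerivAt G (innerSL ℝ (DG y)) y) : IsSubgradAt G DG y := by
  intro k
  have hconv : ConvexOn ℝ Set.univ fun t : ℝ => G (y + t • incl μ k) := by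
    simpa [Function.comp_def] using
      (hG.translate_right y).comp_linearMap (LinearMap.toSpanSingleton ℝ X (incl μ k))
  have hslope := hconv.le_slope_of_hasDerivAt (Set.mem_univ 0) (Set.mem_univ 1) one_pos
    (h.hasDerivAt k)
  simp only [slope_def_field, one_smul, zero_smul, add_zero, sub_zero, div_one,
    innerSL_apply_apply] at hslope
  linarith

theorem abs_le_of_mem_steepSet {G : X → ℝ} {DG : X → CM μ} {v : CM μ} {K : ℝ} {y y' : X}
    (hy : y ∈ steepSet G DG v K) (hy' : y' ∈ steepSet G DG v K) {s : ℝ} {w : CM μ}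
    (h : y' = y + incl μ (s • v + w)) :
    |s| ≤ K ^ 2 * ‖w‖ := by
  refine abs_le'.2 ⟨le_of_mem_steepSet hy (h ▸ hy'.1), ?_⟩
  have hback : y' + incl μ ((-s) • v + -w) = y := by
    rw [h, neg_smul, ← neg_add, incl_neg, add_neg_cancel_right]
  simpa using le_of_mem_steepSet hy' (hback.symm ▸ hy.1 : G (y' + incl μ ((-s) • v + -w)) = 0)

end Subgradient

/-! ### Slices touching the level set -/

theorem measurableSet_exists_mem_lt {X E : Type*} [MeasurableSpace X] [TopologicalSpace E]
    [SecondCountableTopology E] {f : X → E → ℝ} (hm : ∀ z, Measurable fun x => f x z)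
    (hc : ∀ x, Continuous (f x)) {U : Set E} (hU : IsOpen U) (a : ℝ) :
    MeasurableSet {x | ∃ z ∈ U, f x z < a} := by
  obtain ⟨D, hD, hdense⟩ := TopologicalSpace.exists_countable_dense E
  have hset : {x | ∃ z ∈ U, f x z < a} = ⋃ z ∈ D ∩ U, {x | f x z < a} := by
    ext x
    simp only [Set.mem_ofPred_eq, Set.mem_iUnion, exists_prop]
    refine ⟨fun ⟨z, hzU, hz⟩ => ?_, fun ⟨z, hz, hlt⟩ => ⟨z, hz.2, hlt⟩⟩
    obtain ⟨z', ⟨hz'U, hz'⟩, hz'D⟩ :=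
      hdense.inter_open_nonempty _ (hU.inter (isOpen_lt (hc x) continuous_const)) ⟨z, hzU, hz⟩
    exact ⟨z', ⟨hz'D, hz'U⟩, hz'⟩
  rw [hset]
  exact .biUnion (hD.mono Set.inter_subset_left) fun z _ =>
    measurableSet_lt (hm z) measurable_const

/-- The base points `x` such that `G` has infimum zero on the slice `x + range T`, but takes
negative values on the slices shifted in the direction `c`. -/
def touchingSet {X E : Type*} [AddCommGroup X] [Module ℝ X] [AddCommGroup E] [Module ℝ E]
    (G : X → ℝ) (T : E →ₗ[ℝ] X) (c : X) : Set X :=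
  {x | (∀ z, 0 ≤ G (x + T z)) ∧ (∀ ε > 0, ∃ z, G (x + T z) < ε) ∧
    ∃ z, ∃ s > (0 : ℝ), G (x + T z + s • c) < 0}

theorem subsingleton_touchingSet_line {X E : Type*} [AddCommGroup X] [Module ℝ X]
    [AddCommGroup E] [Module ℝ E] {G : X → ℝ} (hG : ConvexOn ℝ Set.univ G) (T : E →ₗ[ℝ] X)
    (x c : X) : {s : ℝ | x + s • c ∈ touchingSet G T c}.Subsingleton := by
  have not_lt : ∀ s₁ s₂ : ℝ, x + s₁ • c ∈ touchingSet G T c → x + s₂ • c ∈ touchingSet G T c →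
      ¬ s₁ < s₂ := by
    rintro s₁ s₂ ⟨hnonneg₁, hinf, -⟩ ⟨hnonneg₂, -, z₀, r, hr, hneg⟩ hlt
    set a : ℝ := (s₂ - s₁) / (s₂ - s₁ + r)
    have hpos : 0 < s₂ - s₁ + r := by linarith
    have ha0 : 0 < a := div_pos (sub_pos.2 hlt) hpos
    have ha1 : a < 1 := (div_lt_one hpos).2 (by linarith)
    have hcomb : s₂ = (1 - a) * s₁ + a * (s₂ + r) := by
      have : a * (s₂ - s₁ + r) = s₂ - s₁ := div_mul_cancel₀ _ hpos.ne'
      linarith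
    obtain ⟨z, hz⟩ := hinf (-a * G (x + s₂ • c + T z₀ + r • c)) (by nlinarith)
    have hconv := hG.2 (Set.mem_univ (x + s₁ • c + T z))
      (Set.mem_univ (x + s₂ • c + T z₀ + r • c)) (sub_nonneg.2 ha1.le) ha0.le (by ring)
    have hpt : (1 - a) • (x + s₁ • c + T z) + a • (x + s₂ • c + T z₀ + r • c)
        = x + s₂ • c + T ((1 - a) • z + a • z₀) := by
      rw [map_add, map_smul, map_smul]
      conv_rhs => rw [hcomb]
      module
    rw [hpt, smul_eq_mul, smul_eq_mul] at hconv
    linarith [hnonneg₂ ((1 - a) • z + a • z₀), mul_nonneg ha0.le (hnonneg₁ z)]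
  exact fun s₁ h₁ s₂ h₂ => le_antisymm (le_of_not_gt (not_lt _ _ h₂ h₁))
    (le_of_not_gt (not_lt _ _ h₁ h₂))

theorem measurableSet_touchingSet {X E : Type*} [AddCommGroup X] [Module ℝ X]
    [MeasurableSpace X] [MeasurableAdd X] [NormedAddCommGroup E] [NormedSpace ℝ E]
    [FiniteDimensional ℝ E] {G : X → ℝ} (hGm : Measurable G) (hG : ConvexOn ℝ Set.univ G)
    (T : E →ₗ[ℝ] X) (c : X) : MeasurableSet (touchingSet G T c) := by
  have hm : ∀ a : X, Measurable fun x => G (x + a) := fun a => hGm.comp (measurable_add_const a)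
  have hinf : ∀ a, MeasurableSet {x | ∃ z, G (x + T z) < a} := fun a => by
    simpa using measurableSet_exists_mem_lt (fun z => hm (T z))
      (fun x => continuous_comp_add_linearMap hG x T) isOpen_univ a
  have hshift : MeasurableSet {x | ∃ z, ∃ s > (0 : ℝ), G (x + T z + s • c) < 0} := by
    have := measurableSet_exists_mem_lt (E := E × ℝ)
      (fun q => hm (T.coprod (LinearMap.toSpanSingleton ℝ X c) q))
      (fun x => continuous_comp_add_linearMap hG x _)
      (isOpen_lt continuous_const continuous_snd : IsOpen {q : E × ℝ | 0 < q.2}) 0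
    simpa [add_assoc] using this
  have hset : touchingSet G T c = {x | ∃ z, G (x + T z) < 0}ᶜ ∩
      ((⋂ n : ℕ, {x | ∃ z, G (x + T z) < 1 / ((n : ℝ) + 1)}) ∩
        {x | ∃ z, ∃ s > (0 : ℝ), G (x + T z + s • c) < 0}) := by
    ext x
    simp only [touchingSet, Set.mem_inter_iff, Set.mem_compl_iff, Set.mem_ofPred_eq, not_exists,
      not_lt, Set.mem_iInter]
    refine and_congr_right fun _ => and_congr_left fun _ =>
      ⟨fun h n => h _ (by positivity), fun h ε hε => ?_⟩
    obtain ⟨n, hn⟩ := exists_nat_one_div_lt hε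
    exact (h n).imp fun z hz => hz.trans hn
  rw [hset]
  exact (hinf 0).compl.inter ((MeasurableSet.iInter fun n => hinf _).inter hshift)

section Gaussian

variable {X : Type*} [NormedAddCommGroup X] [NormedSpace ℝ X] [CompleteSpace X]
  [SecondCountableTopology X] [MeasurableSpace X] [BorelSpace X] {μ : Measure X} [IsGaussian μ]

theorem ae_notMem_touchingSet (hμ : IsCentered μ) {G : X → ℝ} (hGm : Measurable G)
    (hG : ConvexOn ℝ Set.univ G) {E : Type*} [NormedAddCommGroup E] [NormedSpace ℝ E]
    [FiniteDimensional ℝ E] (T : E →ₗ[ℝ] X) (u : CM μ) :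
    ∀ᵐ x ∂μ, x ∉ touchingSet G T (incl μ u) :=
  ae_notMem_of_ae_ae hμ u (measurableSet_touchingSet hGm hG T _) <| .of_forall fun x =>
    (measure_eq_zero_iff_ae_notMem (s := {s : ℝ | x + s • incl μ u ∈ touchingSet G T (incl μ u)})).1
      ((subsingleton_touchingSet_line hG T x _).measure_zero volume)

theorem HasHDerivAt.inner_nonneg {G : X → ℝ} {DG : CM μ} {y : X}
    (h : HasHDerivAt G (innerSL ℝ DG) y) {k : CM μ}
    (hk : ∀ s > (0 : ℝ), G y ≤ G (y + s • incl μ k)) : 0 ≤ ⟪DG, k⟫_ℝ := by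
  have hslope := (hasDerivWithinAt_iff_tendsto_slope' (Set.self_notMem_Ioi (a := (0 : ℝ)))).1
    (h.hasDerivAt k).hasDerivWithinAt
  refine ge_of_tendsto hslope (eventually_nhdsWithin_of_forall fun s hs => ?_)
  rw [slope_def_field, zero_smul, add_zero]
  exact div_nonneg (sub_nonneg.2 (hk s hs)) (sub_nonneg.2 (le_of_lt hs))

theorem HasHDerivAt.eq_zero_of_dense {G : X → ℝ} {DG : CM μ} {y : X}
    (h : HasHDerivAt G (innerSL ℝ DG) y) {D : Set (CM μ)} (hD : Dense D)
    (hmin : ∀ k ∈ D, ∀ s > (0 : ℝ), G y ≤ G (y + s • incl μ k)) : DG = 0 := by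
  have hclosed : IsClosed {k : CM μ | 0 ≤ ⟪DG, k⟫_ℝ} :=
    isClosed_le continuous_const (continuous_const.inner continuous_id)
  have hall : ∀ k : CM μ, 0 ≤ ⟪DG, k⟫_ℝ := fun k =>
    hclosed.closure_subset_iff.2 (fun k hk => h.inner_nonneg (hmin k hk)) (hD k)
  have hneg := hall (-DG)
  rw [inner_neg_right, real_inner_self_eq_norm_sq] at hneg
  exact norm_eq_zero.1 (pow_eq_zero_iff two_ne_zero |>.1 (by linarith [sq_nonneg ‖DG‖]))

instance : SecondCountableTopology (CM μ) :=
  have : Fact ((2 : ℝ≥0∞) ≠ ⊤) := ⟨by norm_num⟩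
  inferInstance

theorem ae_exists_inner_ne_zero_slice (hμ : IsCentered μ) {G : X → ℝ} (hGm : Measurable G)
    (hG : ConvexOn ℝ Set.univ G) (DG : X → CM μ) {E : Type*} [NormedAddCommGroup E]
    [NormedSpace ℝ E] [FiniteDimensional ℝ E] (V : E →ₗ[ℝ] CM μ) :
    ∀ᵐ x ∂μ, ∀ z₀ : E, G (x + incl μ (V z₀)) = 0 →
      HasHDerivAt G (innerSL ℝ (DG (x + incl μ (V z₀)))) (x + incl μ (V z₀)) →
      DG (x + incl μ (V z₀)) ≠ 0 → ∃ z, ⟪DG (x + incl μ (V z₀)), V z⟫_ℝ ≠ 0 := by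
  obtain ⟨D, hD, hdense⟩ := TopologicalSpace.exists_countable_dense (CM μ)
  have htouch := (ae_ball_iff hD).2 fun k _ =>
    ae_notMem_touchingSet hμ hGm hG ((inclCLM μ).toLinearMap ∘ₗ V) k
  filter_upwards [htouch] with x hx z₀ h0 hderiv hne
  by_contra! hcrit
  set y := x + incl μ (V z₀)
  have hmin : ∀ z, 0 ≤ G (x + incl μ (V z)) := fun z => by
    have hy : y + incl μ (V (z - z₀)) = x + incl μ (V z) := by
      rw [map_sub, incl_sub, add_add_sub_cancel]
    simpa only [h0, hcrit, add_zero, hy] using hderiv.isSubgradAt hG (V (z - z₀))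
  refine hne (hderiv.eq_zero_of_dense hdense fun k hk s hs => ?_)
  by_contra! hneg
  exact hx k hk ⟨hmin, fun ε hε => ⟨z₀, h0.trans_lt hε⟩, z₀, s, hs, hneg.trans_eq h0⟩

end Gaussian

/-! ### Transfer of properties of lines to the level set -/

section Transfer

variable {X : Type*} [NormedAddCommGroup X] [NormedSpace ℝ X] [CompleteSpace X]
  [SecondCountableTopology X] [MeasurableSpace X] [BorelSpace X] {μ : Measure X} [IsGaussian μ]

theorem exists_invariant_null_superset (hμ : IsCentered μ) {u : CM μ} {Q : X → Prop}
    (hinv : ∀ x (s : ℝ), Q x → Q (x + s • incl μ u)) (hQ : ∀ᵐ x ∂μ, Q x) :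
    ∃ N : Set X, MeasurableSet N ∧ (∀ᵐ x ∂μ, x ∉ N) ∧
      (∀ x (s : ℝ), x + s • incl μ u ∈ N → x ∈ N) ∧ ∀ x, ¬ Q x → x ∈ N := by
  set M := toMeasurable μ {x | ¬ Q x}
  have hM : MeasurableSet M := measurableSet_toMeasurable _ _
  have hM0 : ∀ᵐ x ∂μ, x ∉ M := by
    rw [← measure_eq_zero_iff_ae_notMem, measure_toMeasurable]
    exact hQ
  have hmap : Measurable fun q : X × ℝ => q.1 + q.2 • incl μ u := by fun_prop
  refine ⟨{x | volume {s : ℝ | x + s • incl μ u ∈ M} ≠ 0}, ?_, ?_, fun x s hx hc => hx ?_,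
    fun x hx hc => ?_⟩
  · exact measurable_measure_prodMk_left (hmap hM) (measurableSet_singleton 0).compl
  · filter_upwards [ae_ae_add_smul hμ u hM0] with x hx hc
    exact hc (measure_eq_zero_iff_ae_notMem.2 hx)
  · have hae : ∀ᵐ t : ℝ, x + t • incl μ u ∉ M := measure_eq_zero_iff_ae_notMem.1 hc
    refine measure_eq_zero_iff_ae_notMem.2 ?_
    filter_upwards [(measurePreserving_add_right volume s).quasiMeasurePreserving.ae hae] with t ht
    rwa [add_comm t s, add_smul, ← add_assoc] at ht
  · obtain ⟨s, hs⟩ := (measure_eq_zero_iff_ae_notMem.1 hc).exists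
    refine hs (subset_toMeasurable μ _ fun hq => hx ?_)
    simpa using hinv _ (-s) hq

variable {G : X → ℝ} {DG : X → CM μ} {S : Set X}

theorem volume_fst_eq_zero_of_volume_snd {u w : CM μ}
    (hS : ∀ y ∈ S, G y = 0 ∧ IsSubgradAt G DG y ∧ 0 < ⟪DG y, u⟫_ℝ) (x : X)
    (h0 : volume {t : ℝ | ∃ s : ℝ, x + s • incl μ u + t • incl μ w ∈ S} = 0) :
    volume {s : ℝ | ∃ t : ℝ, x + s • incl μ u + t • incl μ w ∈ S} = 0 := by
  set P : ℕ → Set (ℝ × ℝ) := fun K =>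
    {q | x + q.1 • incl μ u + q.2 • incl μ w ∈ S ∩ steepSet G DG u K}
  have hcover : {s : ℝ | ∃ t : ℝ, x + s • incl μ u + t • incl μ w ∈ S} ⊆
      ⋃ K, Prod.fst '' P K := by
    rintro s ⟨t, ht⟩
    obtain ⟨h0, hsub, hu⟩ := hS _ ht
    obtain ⟨K, hK⟩ := exists_nat_mem_steepSet h0 hsub hu
    exact Set.mem_iUnion.2 ⟨K, (s, t), ⟨ht, hK⟩, rfl⟩
  refine measure_mono_null hcover (measure_iUnion_null fun K => ?_)
  have hsnd : μH[1] (Prod.snd '' P K) = 0 := by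
    rw [hausdorffMeasure_real]
    refine measure_mono_null ?_ h0
    rintro _ ⟨q, hq, rfl⟩
    exact ⟨q.1, hq.1⟩
  rw [← hausdorffMeasure_real]
  refine hausdorffMeasure_image_eq_zero (C := K ^ 2 * ‖w‖₊) zero_le_one (fun p hp q hq => ?_) hsnd
  have hpq : x + q.1 • incl μ u + q.2 • incl μ w = x + p.1 • incl μ u + p.2 • incl μ w +
      incl μ ((q.1 - p.1) • u + (q.2 - p.2) • w) := by
    rw [incl_add, incl_smul, incl_smul]
    module
  have hlip := abs_le_of_mem_steepSet hp.2 hq.2 hpq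
  rw [norm_smul, Real.norm_eq_abs] at hlip
  rw [edist_nndist, edist_nndist, ← ENNReal.coe_mul, ENNReal.coe_le_coe, ← NNReal.coe_le_coe]
  push_cast
  rw [Real.dist_eq, Real.dist_eq, abs_sub_comm p.1, abs_sub_comm p.2]
  linarith

theorem measurableSet_exists_add_smul_mem (hSm : MeasurableSet S) {w : CM μ}
    (hS : ∀ y ∈ S, G y = 0 ∧ IsSubgradAt G DG y ∧ 0 < ⟪DG y, w⟫_ℝ) :
    MeasurableSet {x | ∃ t : ℝ, x + t • incl μ w ∈ S} := by
  have le_of_mem : ∀ (x : X) (t₁ t₂ : ℝ), x + t₁ • incl μ w ∈ S → x + t₂ • incl μ w ∈ S →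
      t₂ ≤ t₁ := by
    intro x t₁ t₂ h₁ h₂
    obtain ⟨h0, hsub, hw⟩ := hS _ h₁
    have hle := hsub ((t₂ - t₁) • w)
    have hpt : x + t₁ • incl μ w + incl μ ((t₂ - t₁) • w) = x + t₂ • incl μ w := by
      rw [incl_smul]
      module
    rw [hpt, CM.inner_smul_right, h0, (hS _ h₂).1, zero_add] at hle
    exact sub_nonpos.1 (nonpos_of_mul_nonpos_left hle hw)
  have hmap : Measurable fun q : X × ℝ => q.1 + q.2 • incl μ w := by fun_prop
  have himage : {x | ∃ t : ℝ, x + t • incl μ w ∈ S} =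
      Prod.fst '' ((fun q : X × ℝ => q.1 + q.2 • incl μ w) ⁻¹' S) := by
    ext x
    simp
  rw [himage]
  refine (hmap hSm).image_of_measurable_injOn measurable_fst ?_
  rintro ⟨x, t₁⟩ h₁ ⟨_, t₂⟩ h₂ rfl
  exact Prod.ext rfl (le_antisymm (le_of_mem _ _ _ h₂ h₁) (le_of_mem _ _ _ h₁ h₂))

theorem ae_line_inner_nonpos (hμ : IsCentered μ) (hSm : MeasurableSet S) {u w : CM μ}
    (hDw : Measurable fun y => ⟪DG y, w⟫_ℝ)
    (hS : ∀ y ∈ S, G y = 0 ∧ IsSubgradAt G DG y ∧ 0 < ⟪DG y, u⟫_ℝ) {N : Set X}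
    (hN : ∀ᵐ x ∂μ, x ∉ N) (hinv : ∀ x (s : ℝ), x + s • incl μ u ∈ N → x ∈ N) (hSN : S ⊆ N) :
    ∀ᵐ x ∂μ, ∀ t : ℝ, x + t • incl μ w ∈ S → ⟪DG (x + t • incl μ w), w⟫_ℝ ≤ 0 := by
  -- In almost every plane parallel to `u` and `w`, the projection of `S` along `u` is null because
  -- it lies in `N`, hence so is the projection along `w`.
  set S' := S ∩ {y | 0 < ⟪DG y, w⟫_ℝ}
  have hS'm : MeasurableSet S' := hSm.inter (measurableSet_lt measurable_const hDw)
  have hS' : ∀ y ∈ S', G y = 0 ∧ IsSubgradAt G DG y ∧ 0 < ⟪DG y, w⟫_ℝ := fun y hy =>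
    ⟨(hS y hy.1).1, (hS y hy.1).2.1, hy.2⟩
  have hnull : ∀ᵐ x ∂μ, x ∉ {x | ∃ t : ℝ, x + t • incl μ w ∈ S'} := by
    refine ae_notMem_of_ae_ae hμ u (measurableSet_exists_add_smul_mem hS'm hS') ?_
    filter_upwards [ae_ae_add_smul hμ w hN] with x hx
    refine measure_eq_zero_iff_ae_notMem.1
      (volume_fst_eq_zero_of_volume_snd (fun y hy => hS y hy.1) x ?_)
    refine measure_mono_null ?_ (measure_eq_zero_iff_ae_notMem.2 hx)
    rintro t ⟨s, hs⟩
    exact hinv _ s (by rw [add_right_comm]; exact hSN hs.1)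
  filter_upwards [hnull] with x hx t ht
  by_contra! hpos
  exact hx ⟨t, ht, hpos⟩

end Transfer

section Slices

variable {X : Type*} [NormedAddCommGroup X] [NormedSpace ℝ X] [CompleteSpace X]
  [SecondCountableTopology X] [MeasurableSpace X] [BorelSpace X] {μ : Measure X} [IsGaussian μ]
  {m : ℕ} {u : Fin (m + 1) → CM μ}

theorem slicePt_eq_add_incl (x : X) (z : EuclideanSpace ℝ (Fin (m + 1))) :
    slicePt μ u x z =
      x + incl μ (Fintype.linearCombination ℝ u fun i => z i - (u i : Lp ℝ 2 μ) x) := by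
  simp only [slicePt, Fintype.linearCombination_apply, incl_sum, incl_smul, sub_smul, incl_sub,
    Finset.sum_sub_distrib]
  abel

theorem slicePt_eq_slicePt_add (i : Fin (m + 1)) (x : X) (z z' : EuclideanSpace ℝ (Fin (m + 1))) :
    slicePt μ u x z' = slicePt μ u x z + incl μ ((z' i - z i) • u i +
      ∑ j, (z' (i.succAbove j) - z (i.succAbove j)) • u (i.succAbove j)) := by
  rw [← Fin.sum_univ_succAbove (fun j => (z' j - z j) • u j) i]
  simp only [slicePt, incl_sum, incl_smul, sub_smul, incl_sub, Finset.sum_sub_distrib]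
  abel

theorem euclideanSpace_dist_le_sum (z z' : EuclideanSpace ℝ (Fin m)) :
    dist z z' ≤ ∑ j, |z j - z' j| := by
  rw [EuclideanSpace.dist_eq]
  simp only [Real.dist_eq]
  rw [Real.sqrt_le_left (Finset.sum_nonneg fun _ _ => abs_nonneg _)]
  exact Finset.sum_sq_le_sq_sum_of_nonneg fun _ _ => abs_nonneg _

theorem dist_le_of_slicePt_mem_steepSet {G : X → ℝ} {DG : X → CM μ} (hu : Orthonormal ℝ u)
    {x : X} (i : Fin (m + 1)) {ε K : ℝ} (hε : |ε| = 1) {z z' : EuclideanSpace ℝ (Fin (m + 1))}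
    (hz : slicePt μ u x z ∈ steepSet G DG (ε • u i) K)
    (hz' : slicePt μ u x z' ∈ steepSet G DG (ε • u i) K) :
    dist z z' ≤ (K ^ 2 * m + m) *
      dist (fun j => z (i.succAbove j)) (fun j => z' (i.succAbove j)) := by
  set δ := dist (fun j => z (i.succAbove j)) (fun j => z' (i.succAbove j))
  have hδ : ∀ j, |z (i.succAbove j) - z' (i.succAbove j)| ≤ δ := fun j =>
    dist_le_pi_dist (fun j => z (i.succAbove j)) (fun j => z' (i.succAbove j)) j
  have hε2 : ε * ε = 1 := by rw [← abs_mul_abs_self, hε, one_mul]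
  set w := ∑ j, (z' (i.succAbove j) - z (i.succAbove j)) • u (i.succAbove j)
  have hw : ‖w‖ ≤ m * δ := by
    refine (norm_sum_le_of_le _ fun j _ => ?_).trans_eq (by simp : ∑ _j : Fin m, δ = m * δ)
    rw [norm_smul, hu.1, mul_one, norm_sub_rev]
    exact hδ j
  have hi : |z i - z' i| ≤ K ^ 2 * ‖w‖ := by
    have hdiff : slicePt μ u x z' = slicePt μ u x z +
        incl μ ((ε * (z' i - z i)) • ε • u i + w) := by
      rw [smul_smul, mul_right_comm, hε2, one_mul]
      exact slicePt_eq_slicePt_add i x z z'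
    simpa only [abs_mul, hε, one_mul, abs_sub_comm] using abs_le_of_mem_steepSet hz hz' hdiff
  calc dist z z' ≤ |z i - z' i| + ∑ j, |z (i.succAbove j) - z' (i.succAbove j)| :=
        (euclideanSpace_dist_le_sum z z').trans_eq (Fin.sum_univ_succAbove _ i)
    _ ≤ K ^ 2 * (m * δ) + ∑ _j : Fin m, δ := by
        gcongr with j
        · exact hi.trans (by gcongr)
        · exact hδ j
    _ = (K ^ 2 * m + m) * δ := by
        simp only [Finset.sum_const, Finset.card_univ, Fintype.card_fin, nsmul_eq_mul]
        ring

theorem ae_volume_image_slicePt_eq_zero (hμ : IsCentered μ) (i : Fin (m + 1)) {S : Set X}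
    (hS : ∀ᵐ x ∂μ, ∀ t : ℝ, x + t • incl μ (u i) ∉ S) :
    ∀ᵐ x ∂μ, volume ((fun (z : EuclideanSpace ℝ (Fin (m + 1))) j => z (i.succAbove j)) ''
      {z | slicePt μ u x z ∈ S}) = 0 := by
  have hmeas : Measurable fun z : Fin m → ℝ => incl μ (∑ j, z j • u (i.succAbove j)) :=
    (continuous_incl.comp (by fun_prop)).measurable
  filter_upwards [ae_ae_add_incl hμ volume hmeas hS] with x hx
  rw [measure_eq_zero_iff_ae_notMem]
  filter_upwards [(measurePreserving_sub_right (volume : Measure (Fin m → ℝ)) fun j =>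
    (u (i.succAbove j) : Lp ℝ 2 μ) x).quasiMeasurePreserving.ae hx] with z' hz'
  rintro ⟨z, hz, rfl⟩
  refine hz' (z i - (u i : Lp ℝ 2 μ) x) ?_
  have hpt : slicePt μ u x z = _ := slicePt_eq_add_incl x z
  rw [Fintype.linearCombination_apply, Fin.sum_univ_succAbove _ i, incl_add, incl_smul,
    add_comm (_ • incl μ (u i)), ← add_assoc] at hpt
  exact hpt ▸ hz

end Slices

section Level

variable {X : Type*} [NormedAddCommGroup X] [NormedSpace ℝ X] [MeasurableSpace X] [BorelSpace X]
  {μ : Measure X}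

/-- `G` is convex and its level set `G⁻¹(0)` is regular: at `ρ`-a.e. point of the level set, `G` is
differentiable along the Cameron–Martin space, with derivative `DG ≠ 0`. This is the setting in
which properties of almost every line pass to the level set. -/
structure ConvexRegularLevel (G : X → ℝ) (DG : X → CM μ) : Prop where
  measurable : Measurable G
  measurable_inner : ∀ w, Measurable fun x => ⟪DG x, w⟫_ℝ
  convexOn : ConvexOn ℝ Set.univ G
  hasHDerivAt : RhoAE μ (G ⁻¹' {0}) fun x => HasHDerivAt G (innerSL ℝ (DG x)) x
  ne_zero : RhoAE μ (G ⁻¹' {0}) fun x => DG x ≠ 0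

variable {G : X → ℝ} {DG : X → CM μ}

theorem exists_inner_ne_zero_of_slice {m : ℕ} {u : Fin (m + 1) → CM μ} {k : CM μ}
    (h : ∃ z, ⟪k, Fintype.linearCombination ℝ u z⟫_ℝ ≠ 0) : ∃ i, ⟪k, u i⟫_ℝ ≠ 0 := by
  by_contra! hzero
  obtain ⟨z, hz⟩ := h
  refine hz ?_
  rw [Fintype.linearCombination_apply, inner_sum]
  exact Finset.sum_eq_zero fun i _ => by rw [CM.inner_smul_right, hzero, mul_zero]

theorem exists_mem_steepSet_of_ne_zero {k : CM μ} {y : X} (h0 : G y = 0)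
    (hsub : IsSubgradAt G DG y) (hk : ⟪DG y, k⟫_ℝ ≠ 0) :
    ∃ K : ℕ, y ∈ steepSet G DG ((1 : ℝ) • k) K ∪ steepSet G DG ((-1 : ℝ) • k) K := by
  rcases hk.lt_or_gt with hneg | hpos
  · obtain ⟨K, hK⟩ := exists_nat_mem_steepSet (v := (-1 : ℝ) • k) h0 hsub
      (by rw [CM.inner_smul_right]; linarith)
    exact ⟨K, .inr hK⟩
  · obtain ⟨K, hK⟩ := exists_nat_mem_steepSet (v := (1 : ℝ) • k) h0 hsub
      (by rw [CM.inner_smul_right]; linarith)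
    exact ⟨K, .inl hK⟩

variable [CompleteSpace X] [SecondCountableTopology X] [IsGaussian μ]

theorem sphericalHausdorff_slice_steepSet_eq_zero (hμ : IsCentered μ) {m : ℕ}
    {u : Fin (m + 1) → CM μ} (hu : Orthonormal ℝ u) {S : Set X}
    (hline : ∀ w : CM μ, ∀ᵐ x ∂μ, ∀ t : ℝ, x + t • incl μ w ∈ S →
      ⟪DG (x + t • incl μ w), w⟫_ℝ = 0) {ε : ℝ} (hε : |ε| = 1) :
    ∀ᵐ x ∂μ, ∀ (i : Fin (m + 1)) (K : ℕ), sphericalHausdorff m (EuclideanSpace ℝ (Fin (m + 1)))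
      {z | slicePt μ u x z ∈ S ∩ steepSet G DG (ε • u i) K} = 0 := by
  refine ae_all_iff.2 fun i => ae_all_iff.2 fun K => ?_
  have hnotMem : ∀ᵐ x ∂μ, ∀ t : ℝ, x + t • incl μ (u i) ∉ S ∩ steepSet G DG (ε • u i) K := by
    filter_upwards [hline (u i)] with x hx
    rintro t ⟨htS, -, -, hsteep, -⟩
    rw [CM.inner_smul_right, hx t htS, mul_zero, mul_zero] at hsteep
    exact not_lt_of_ge hsteep one_pos
  filter_upwards [ae_volume_image_slicePt_eq_zero hμ i hnotMem] with x hx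
  refine sphericalHausdorff_graph_eq_zero i (C := K ^ 2 * m + m) (fun z hz z' hz' => ?_) hx
  simpa using dist_le_of_slicePt_mem_steepSet hu i hε hz.2 hz'.2

theorem ConvexRegularLevel.rho_eq_zero (h : ConvexRegularLevel G DG) (hμ : IsCentered μ)
    {S : Set X} (hSm : MeasurableSet S) (hS : ∀ y ∈ S, G y = 0)
    (hline : ∀ w : CM μ, ∀ᵐ x ∂μ, ∀ t : ℝ, x + t • incl μ w ∈ S →
      ⟪DG (x + t • incl μ w), w⟫_ℝ = 0) : rho μ S = 0 := by
  obtain ⟨N, hN, hN0, hreg⟩ := h.hasHDerivAt.and h.ne_zero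
  rw [rho_eq_zero_iff hSm]
  intro m u hu
  filter_upwards [(rho_eq_zero_iff hN).1 hN0 m u hu,
    ae_exists_inner_ne_zero_slice hμ h.measurable h.convexOn DG (Fintype.linearCombination ℝ u),
    sphericalHausdorff_slice_steepSet_eq_zero (G := G) hμ hu hline abs_one,
    sphericalHausdorff_slice_steepSet_eq_zero (G := G) hμ hu hline (ε := -1) (by simp)]
    with x hxN hxgrad hxpos hxneg
  have hcover : {z | slicePt μ u x z ∈ S} ⊆ {z | slicePt μ u x z ∈ N} ∪
      ⋃ (i) (K : ℕ), ({z | slicePt μ u x z ∈ S ∩ steepSet G DG ((1 : ℝ) • u i) K} ∪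
        {z | slicePt μ u x z ∈ S ∩ steepSet G DG ((-1 : ℝ) • u i) K}) := by
    intro z hz
    refine or_iff_not_imp_left.2 fun hzN => ?_
    have hzS : slicePt μ u x z ∈ S := hz
    obtain ⟨hderiv, hne⟩ := hreg _ (hS _ hzS) hzN
    obtain ⟨i, hi⟩ : ∃ i, ⟪DG (slicePt μ u x z), u i⟫_ℝ ≠ 0 := by
      refine exists_inner_ne_zero_of_slice ?_
      rw [slicePt_eq_add_incl] at hzS hderiv hne ⊢
      exact hxgrad _ (hS _ hzS) hderiv hne
    obtain ⟨K, hK⟩ := exists_mem_steepSet_of_ne_zero (hS _ hzS) (hderiv.isSubgradAt h.convexOn) hi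
    exact Set.mem_iUnion₂.2 ⟨i, K, hK.imp (⟨hzS, ·⟩) (⟨hzS, ·⟩)⟩
  exact measure_mono_null hcover (measure_union_null hxN (measure_iUnion_null fun i =>
    measure_iUnion_null fun K => measure_union_null (hxpos i K) (hxneg i K)))

theorem ConvexRegularLevel.rhoAE_of_invariant (h : ConvexRegularLevel G DG) (hμ : IsCentered μ)
    {u : CM μ} {Q : X → Prop} (hinv : ∀ x (s : ℝ), Q x → Q (x + s • incl μ u))
    (hQ : ∀ᵐ x ∂μ, Q x) : RhoAE μ (G ⁻¹' {0}) fun y => 0 < ⟪DG y, u⟫_ℝ → Q y := by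
  obtain ⟨N, hNm, hN0, hNinv, hNQ⟩ := exists_invariant_null_superset hμ hinv hQ
  obtain ⟨M, hMm, hM0, hderiv⟩ := h.hasHDerivAt
  set S : Set X := {y | G y = 0} ∩ (Mᶜ ∩ ({y | 0 < ⟪DG y, u⟫_ℝ} ∩ N))
  have hSm : MeasurableSet S := (h.measurable (measurableSet_singleton 0)).inter
    (hMm.compl.inter ((measurableSet_lt measurable_const (h.measurable_inner u)).inter hNm))
  have hS : ∀ y ∈ S, G y = 0 ∧ IsSubgradAt G DG y ∧ 0 < ⟪DG y, u⟫_ℝ := fun y hy =>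
    ⟨hy.1, (hderiv y hy.1 hy.2.1).isSubgradAt h.convexOn, hy.2.2.1⟩
  have hnonpos : ∀ w : CM μ, ∀ᵐ x ∂μ, ∀ t : ℝ, x + t • incl μ w ∈ S →
      ⟪DG (x + t • incl μ w), w⟫_ℝ ≤ 0 := fun w =>
    ae_line_inner_nonpos hμ hSm (h.measurable_inner w) hS hN0 hNinv fun y hy => hy.2.2.2
  have hS0 : rho μ S = 0 := by
    refine h.rho_eq_zero hμ hSm (fun y hy => hy.1) fun w => ?_
    filter_upwards [hnonpos w, hnonpos (-w)] with x hx hx' t ht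
    refine le_antisymm (hx t ht) ?_
    simpa [incl_neg] using hx' (-t) (by simpa [incl_neg] using ht)
  have hnotMem : RhoAE μ (G ⁻¹' {0}) fun y => y ∉ M ∧ y ∉ S :=
    RhoAE.and ⟨M, hMm, hM0, fun _ _ => id⟩ ⟨S, hSm, hS0, fun _ _ => id⟩
  exact RhoAE.mono hnotMem fun y hy hyMS hu => by_contra fun hyQ =>
    hyMS.2 ⟨hy, hyMS.1, hu, hNQ y hyQ⟩

end Level

/-! ### Absolute continuity on lines and traces -/

theorem tendsto_ae_of_tsum_lintegral_enorm_sub_ne_top {Z : Type*} [MeasurableSpace Z]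
    {ν : Measure Z} {f : ℕ → Z → ℝ} {φ : Z → ℝ} (hf : ∀ n, Measurable (f n)) (hφ : Measurable φ)
    (hsum : ∑' n, ∫⁻ z, ‖f n z - φ z‖ₑ ∂ν ≠ ⊤) :
    ∀ᵐ z ∂ν, Tendsto (fun n => f n z) atTop (𝓝 (φ z)) := by
  have hm : ∀ n, Measurable fun z => ‖f n z - φ z‖ₑ := fun n => ((hf n).sub hφ).enorm
  rw [← lintegral_tsum fun n => (hm n).aemeasurable] at hsum
  filter_upwards [ae_lt_top (Measurable.tsum hm) hsum] with z hz
  rw [tendsto_iff_edist_tendsto_0]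
  simpa only [edist_eq_enorm_sub] using ENNReal.tendsto_atTop_zero_of_tsum_ne_top hz.ne

theorem frequently_nhdsLT_of_ae_Icc {a b : ℝ} (hab : a < b) {P : ℝ → Prop}
    (h : ∀ᵐ t ∂volume.restrict (Set.Icc a b), P t) : ∃ᶠ t in 𝓝[<] b, P t := by
  intro hnot
  obtain ⟨l, hl, hsub⟩ := mem_nhdsLT_iff_exists_Ioo_subset.1 hnot
  have hIoo : Set.Ioo (max l a) b ⊆ Set.Icc a b := fun t ht =>
    ⟨(le_max_right l a).trans ht.1.le, ht.2.le⟩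
  have : (ae (volume.restrict (Set.Ioo (max l a) b))).NeBot := by
    rw [ae_neBot, Ne, Measure.restrict_eq_zero, Real.volume_Ioo, ENNReal.ofReal_eq_zero, not_le]
    exact sub_pos.2 (max_lt hl hab)
  obtain ⟨t, htP, ht⟩ :=
    ((ae_restrict_of_ae_restrict_of_subset hIoo h).and (ae_restrict_mem measurableSet_Ioo)).exists
  exact hsub ⟨(le_max_left l a).trans_lt ht.1, ht.2⟩ htP

/-- `f` has on `[a, b]` a continuous version with value `τ` at `b`. -/
def HasEndValue (f : ℝ → ℝ) (a b τ : ℝ) : Prop :=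
  ∃ F : ℝ → ℝ, ContinuousOn F (Set.Icc a b) ∧
    (∀ᵐ t ∂volume.restrict (Set.Icc a b), f t = F t) ∧ F b = τ

theorem HasEndValue.linearCombination {f g : ℝ → ℝ} {a b σ τ : ℝ} (hf : HasEndValue f a b σ)
    (hg : HasEndValue g a b τ) (α β : ℝ) :
    HasEndValue (fun t => α * f t + β * g t) a b (α * σ + β * τ) := by
  obtain ⟨F, hFc, hfF, rfl⟩ := hf
  obtain ⟨K, hKc, hgK, rfl⟩ := hg
  refine ⟨fun t => α * F t + β * K t, (hFc.const_mul α).add (hKc.const_mul β), ?_, rfl⟩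
  filter_upwards [hfF, hgK] with t hf hg
  rw [hf, hg]

theorem HasEndValue.eq_of_continuousWithinAt {f : ℝ → ℝ} {a b τ : ℝ} (h : HasEndValue f a b τ)
    (hab : a < b) (hf : ContinuousWithinAt f (Set.Iio b) b) : f b = τ := by
  obtain ⟨F, hFc, hfF, rfl⟩ := h
  exact tendsto_nhds_unique_of_frequently_eq hf
    ((hFc b ⟨hab.le, le_rfl⟩).mono_of_mem_nhdsWithin (Icc_mem_nhdsLT hab))
    (frequently_nhdsLT_of_ae_Icc hab hfF)

theorem eq_of_hasDerivWithinAt_of_frequently_eq {f g : ℝ → ℝ} {f' g' b : ℝ}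
    (hf : HasDerivWithinAt f f' (Set.Iio b) b) (hg : HasDerivWithinAt g g' (Set.Iio b) b)
    (hb : f b = g b) (h : ∃ᶠ t in 𝓝[<] b, f t = g t) : f' = g' := by
  rw [hasDerivWithinAt_iff_tendsto_slope' Set.self_notMem_Iio] at hf hg
  refine tendsto_nhds_unique_of_frequently_eq hf hg (h.mono fun t ht => ?_)
  rw [slope_def_field, slope_def_field, ht, hb]

/-- On `[a, b]` the function `φ` is almost everywhere equal to `C + ∫ₐᵗ γ`. -/
def PrimitiveOn (φ γ : ℝ → ℝ) (a b C : ℝ) : Prop :=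
  IntegrableOn γ (Set.Icc a b) ∧
    ∀ᵐ t ∂volume.restrict (Set.Icc a b), φ t = C + ∫ s in a..t, γ s

section Primitive

variable {φ γ : ℝ → ℝ} {a b C : ℝ}

theorem PrimitiveOn.continuousOn (h : PrimitiveOn φ γ a b C) (hab : a ≤ b) :
    ContinuousOn (fun t => C + ∫ s in a..t, γ s) (Set.Icc a b) := by
  have := intervalIntegral.continuousOn_primitive_interval (a := a) (b := b) (f := γ) (μ := volume)
    (by rw [Set.uIcc_of_le hab]; exact h.1)
  rw [Set.uIcc_of_le hab] at this
  exact continuousOn_const.add this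

theorem hasDerivWithinAt_integral_of_hasEndValue (hab : a < b) (hγ : IntegrableOn γ (Set.Icc a b))
    {τ : ℝ} (h : HasEndValue γ a b τ) :
    HasDerivWithinAt (fun t => ∫ s in a..t, γ s) τ (Set.Iio b) b := by
  obtain ⟨F, hFc, hγF, rfl⟩ := h
  have hFint : IntegrableOn F (Set.Icc a b) := hγ.congr hγF
  have hb : b ∈ Set.Icc a b := ⟨hab.le, le_rfl⟩
  have : Fact (b ∈ Set.Icc a b) := ⟨hb⟩
  have hderiv : HasDerivWithinAt (fun t => ∫ s in a..t, F s) (F b) (Set.Icc a b) b :=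
    intervalIntegral.integral_hasDerivWithinAt_right
      ((intervalIntegrable_iff_integrableOn_Icc_of_le hab.le).2 hFint)
      ⟨Set.Icc a b, self_mem_nhdsWithin, hFint.1⟩ (hFc b hb)
  refine (hderiv.congr_of_mem (fun t ht => ?_) hb).mono_of_mem_nhdsWithin (Icc_mem_nhdsLT hab)
  have hsub : Set.Ioc a t ⊆ Set.Icc a b := fun s hs => ⟨hs.1.le, hs.2.trans ht.2⟩
  refine intervalIntegral.integral_congr_ae_restrict ?_
  rw [Set.uIoc_of_le ht.1]
  exact ae_restrict_of_ae_restrict_of_subset hsub hγF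

theorem PrimitiveOn.deriv_eq_of_hasEndValue (h : PrimitiveOn φ γ a b C) (hab : a < b) {φ' τ : ℝ}
    (hφ : HasDerivAt φ φ' b) (hγ : HasEndValue γ a b τ) : φ' = τ := by
  refine eq_of_hasDerivWithinAt_of_frequently_eq hφ.hasDerivWithinAt
    ((hasDerivWithinAt_integral_of_hasEndValue hab h.1 hγ).const_add C) ?_
    (frequently_nhdsLT_of_ae_Icc hab h.2)
  exact HasEndValue.eq_of_continuousWithinAt ⟨_, h.continuousOn hab.le, h.2, rfl⟩ hab
    hφ.continuousAt.continuousWithinAt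

theorem tendsto_intervalIntegral_of_tsum_ne_top {g : ℕ → ℝ → ℝ}
    (hg : ∀ n, IntegrableOn (g n) (Set.Icc a b)) (hγ : IntegrableOn γ (Set.Icc a b))
    (hsum : ∑' n, ∫⁻ t in Set.Icc a b, ‖g n t - γ t‖ₑ ≠ ⊤) {t : ℝ} (ht : t ∈ Set.Icc a b) :
    Tendsto (fun n => ∫ s in a..t, g n s) atTop (𝓝 (∫ s in a..t, γ s)) := by
  have hsub : Set.Ioc a t ⊆ Set.Icc a b := fun s hs => ⟨hs.1.le, hs.2.trans ht.2⟩
  simp only [intervalIntegral.integral_of_le ht.1]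
  exact tendsto_integral_of_L1 _ (hγ.mono_set hsub).1 (.of_forall fun n => (hg n).mono_set hsub)
    (tendsto_of_tendsto_of_tendsto_of_le_of_le tendsto_const_nhds
      (ENNReal.tendsto_atTop_zero_of_tsum_ne_top hsum) (fun _ => zero_le)
      fun _ => lintegral_mono_set hsub)

theorem PrimitiveOn.exists_limit (hab : a < b) {f g : ℕ → ℝ → ℝ} (hfm : ∀ n, Measurable (f n))
    (hgm : ∀ n, Measurable (g n)) (hφm : Measurable φ) (hγm : Measurable γ) {C : ℕ → ℝ}
    (h : ∀ n, PrimitiveOn (f n) (g n) a b (C n))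
    (hf : ∑' n, ∫⁻ t in Set.Icc a b, ‖f n t - φ t‖ₑ ≠ ⊤)
    (hg : ∑' n, ∫⁻ t in Set.Icc a b, ‖g n t - γ t‖ₑ ≠ ⊤) :
    ∃ c, PrimitiveOn φ γ a b c ∧ ∀ t ∈ Set.Icc a b,
      Tendsto (fun n => C n + ∫ s in a..t, g n s) atTop (𝓝 (c + ∫ s in a..t, γ s)) := by
  have hγ : IntegrableOn γ (Set.Icc a b) := by
    have hsub : IntegrableOn (g 0 - γ) (Set.Icc a b) :=
      ⟨((hgm 0).sub hγm).aestronglyMeasurable, (ENNReal.ne_top_of_tsum_ne_top hg 0).lt_top⟩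
    simpa only [sub_sub_cancel] using (h 0).1.sub hsub
  have hint : ∀ t ∈ Set.Icc a b,
      Tendsto (fun n => ∫ s in a..t, g n s) atTop (𝓝 (∫ s in a..t, γ s)) := fun t ht =>
    tendsto_intervalIntegral_of_tsum_ne_top (fun n => (h n).1) hγ hg ht
  have hC : ∀ᵐ t ∂volume.restrict (Set.Icc a b),
      Tendsto C atTop (𝓝 (φ t - ∫ s in a..t, γ s)) := by
    filter_upwards [tendsto_ae_of_tsum_lintegral_enorm_sub_ne_top hfm hφm hf,
      ae_all_iff.2 fun n => (h n).2, ae_restrict_mem measurableSet_Icc] with t hft heq ht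
    exact (hft.sub (hint t ht)).congr fun n => by rw [heq n, add_sub_cancel_right]
  have : (ae (volume.restrict (Set.Icc a b))).NeBot := by
    rw [ae_neBot, Ne, Measure.restrict_eq_zero, Real.volume_Icc, ENNReal.ofReal_eq_zero, not_le]
    exact sub_pos.2 hab
  obtain ⟨t₀, ht₀⟩ := hC.exists
  refine ⟨_, ⟨hγ, ?_⟩, fun t ht => ht₀.add (hint t ht)⟩
  filter_upwards [hC] with t ht
  rw [tendsto_nhds_unique ht₀ ht, sub_add_cancel]

end Primitive

theorem exists_tsum_comp_ne_top {a : ℕ → ℝ≥0∞} (h : Tendsto a atTop (𝓝 0)) :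
    ∃ θ : ℕ → ℕ, ∑' n, a (θ n) ≠ ⊤ := by
  obtain ⟨η, hη0, hη⟩ := ENNReal.exists_pos_sum_of_countable' (one_ne_zero (α := ℝ≥0∞)) ℕ
  choose θ hθ using fun n => (h.eventually_le_const (hη0 n)).exists
  exact ⟨θ, ((ENNReal.tsum_le_tsum hθ).trans_lt (hη.trans ENNReal.one_lt_top)).ne⟩

theorem enorm_le_l2norm {κ : Type*} (a : κ → ℝ) (s : κ) : ‖a s‖ₑ ≤ l2norm a := by
  have hsq : ‖a s‖ₑ = ENNReal.ofReal (a s ^ 2) ^ (1 / 2 : ℝ) := by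
    rw [← sq_abs, ENNReal.ofReal_pow (abs_nonneg _), ← ENNReal.rpow_natCast, ← ENNReal.rpow_mul,
      ← Real.enorm_eq_ofReal_abs]
    norm_num
  rw [hsq]
  exact ENNReal.rpow_le_rpow (ENNReal.le_tsum (f := fun s => ENNReal.ofReal (a s ^ 2)) s)
    (by norm_num)

section Moments

variable {Z : Type*} [MeasurableSpace Z] {ν : Measure Z} [IsFiniteMeasure ν] {p : ℝ}

theorem tendsto_lintegral_of_tendsto_lintegral_rpow (hp : 1 < p) {h : ℕ → Z → ℝ≥0∞}
    (hm : ∀ n, Measurable (h n)) (hlim : Tendsto (fun n => ∫⁻ z, h n z ^ p ∂ν) atTop (𝓝 0)) :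
    Tendsto (fun n => ∫⁻ z, h n z ∂ν) atTop (𝓝 0) := by
  have hpq := Real.HolderConjugate.conjExponent hp
  have hle : ∀ n, ∫⁻ z, h n z ∂ν ≤ (∫⁻ z, h n z ^ p ∂ν) ^ (1 / p) *
      (ν Set.univ) ^ (1 / p.conjExponent) := fun n => by
    simpa using ENNReal.lintegral_mul_le_Lp_mul_Lq ν hpq (hm n).aemeasurable
      (aemeasurable_const (b := (1 : ℝ≥0∞)))
  have hroot : Tendsto (fun n => (∫⁻ z, h n z ^ p ∂ν) ^ (1 / p)) atTop (𝓝 0) := by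
    have := (ENNReal.continuous_rpow_const (y := 1 / p)).tendsto 0 |>.comp hlim
    rwa [ENNReal.zero_rpow_of_pos (one_div_pos.2 (zero_lt_one.trans hp))] at this
  have hbound := ENNReal.Tendsto.mul_const (b := (ν Set.univ) ^ (1 / p.conjExponent)) hroot
    (Or.inr (ENNReal.rpow_ne_top_of_nonneg (one_div_nonneg.2 hpq.symm.pos.le)
      (measure_ne_top ν _)))
  rw [zero_mul] at hbound
  exact tendsto_of_tendsto_of_tendsto_of_le_of_le tendsto_const_nhds hbound (fun _ => zero_le) hle

variable {κ : Type*} {A : Z → κ → ℝ} {B : ℕ → Z → κ → ℝ}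

theorem tendsto_lintegral_enorm_sub_of_l2norm (hp : 1 < p) (hA : ∀ s, Measurable fun z => A z s)
    (hB : ∀ n s, Measurable fun z => B n z s)
    (hlim : Tendsto (fun n => ∫⁻ z, l2norm (fun s => A z s - B n z s) ^ p ∂ν) atTop (𝓝 0))
    (s : κ) : Tendsto (fun n => ∫⁻ z, ‖B n z s - A z s‖ₑ ∂ν) atTop (𝓝 0) := by
  refine tendsto_lintegral_of_tendsto_lintegral_rpow hp (fun n => ((hB n s).sub (hA s)).enorm) ?_
  refine tendsto_of_tendsto_of_tendsto_of_le_of_le tendsto_const_nhds hlim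
    (fun _ => zero_le) fun n => lintegral_mono fun z => ?_
  simp only [enorm_sub_rev (B n z s)]
  exact ENNReal.rpow_le_rpow (enorm_le_l2norm (fun s => A z s - B n z s) s)
    (zero_le_one.trans hp.le)

theorem tendsto_lintegral_enorm_linearCombination_sub (hp : 1 < p)
    (hA : ∀ s, Measurable fun z => A z s) (hB : ∀ n s, Measurable fun z => B n z s)
    (hlim : Tendsto (fun n => ∫⁻ z, l2norm (fun s => A z s - B n z s) ^ p ∂ν) atTop (𝓝 0))
    (α β : ℝ) (s s' : κ) :
    Tendsto (fun n => ∫⁻ z, ‖(α * B n z s + β * B n z s') - (α * A z s + β * A z s')‖ₑ ∂ν)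
      atTop (𝓝 0) := by
  have hcoord := tendsto_lintegral_enorm_sub_of_l2norm hp hA hB hlim
  have hsum := (ENNReal.Tendsto.const_mul (a := ‖α‖ₑ) (hcoord s) (Or.inr enorm_ne_top)).add
    (ENNReal.Tendsto.const_mul (a := ‖β‖ₑ) (hcoord s') (Or.inr enorm_ne_top))
  rw [mul_zero, mul_zero, add_zero] at hsum
  refine tendsto_of_tendsto_of_tendsto_of_le_of_le tendsto_const_nhds hsum
    (fun _ => zero_le) fun n => ?_
  have hm : ∀ s, Measurable fun z => ‖B n z s - A z s‖ₑ := fun s => ((hB n s).sub (hA s)).enorm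
  rw [← lintegral_const_mul _ (hm s), ← lintegral_const_mul _ (hm s'),
    ← lintegral_add_left ((hm s).const_mul _)]
  refine lintegral_mono fun z => ?_
  rw [← enorm_mul, ← enorm_mul]
  refine le_of_eq_of_le (congrArg _ ?_) (enorm_add_le _ _)
  ring

end Moments

section LineAC

variable {X : Type*} [NormedAddCommGroup X] [NormedSpace ℝ X] [MeasurableSpace X] [BorelSpace X]
  {μ : Measure X}

/-- On the segments in `Ω` of almost all lines of direction `u`, the function `φ` is absolutely
continuous with derivative `γ`. -/
def LineAC (u : CM μ) (Ω : Set X) (φ γ : X → ℝ) : Prop :=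
  ∀ᵐ x ∂μ, ∀ a b : ℝ, a < b → (∀ t ∈ Set.Icc a b, x + t • incl μ u ∈ Ω) →
    ∃ C, PrimitiveOn (fun t => φ (x + t • incl μ u)) (fun t => γ (x + t • incl μ u)) a b C

variable {u : CM μ} {Ω : Set X}

theorem lineAC_of_contDiff (u : CM μ) (Ω : Set X) {f : X → ℝ} (hf : ContDiff ℝ 1 f) :
    LineAC u Ω f fun x => fderiv ℝ f x (incl μ u) := by
  refine Eventually.of_forall fun x a b _ _ => ⟨f (x + a • incl μ u), ?_⟩
  have hderiv : ∀ t : ℝ, HasDerivAt (fun t : ℝ => f (x + t • incl μ u))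
      (fderiv ℝ f (x + t • incl μ u) (incl μ u)) t := fun t => by
    have hline : HasDerivAt (fun t : ℝ => x + t • incl μ u) (incl μ u) t := by
      simpa using ((hasDerivAt_id t).smul_const (incl μ u)).const_add x
    exact (hf.differentiable one_ne_zero _).hasFDerivAt.comp_hasDerivAt t hline
  have hcont : Continuous fun t : ℝ => fderiv ℝ f (x + t • incl μ u) (incl μ u) :=
    ((hf.continuous_fderiv one_ne_zero).comp (by fun_prop)).clm_apply continuous_const
  refine ⟨hcont.continuousOn.integrableOn_Icc, .of_forall fun t => ?_⟩
  rw [intervalIntegral.integral_eq_sub_of_hasDerivAt (fun s _ => hderiv s)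
    (hcont.intervalIntegrable _ _), add_sub_cancel]

variable [CompleteSpace X] [SecondCountableTopology X] [IsGaussian μ]

theorem ae_tsum_lintegral_line_ne_top (hμ : IsCentered μ) (u : CM μ) (hΩ : MeasurableSet Ω)
    {F : ℕ → X → ℝ≥0∞} (hF : ∀ n, Measurable (F n)) (hfin : ∑' n, ∫⁻ x in Ω, F n x ∂μ ≠ ⊤) :
    ∀ᵐ x ∂μ, ∀ a b : ℝ, (∀ t ∈ Set.Icc a b, x + t • incl μ u ∈ Ω) →
      ∑' n, ∫⁻ t in Set.Icc a b, F n (x + t • incl μ u) ≠ ⊤ := by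
  have hint : ∫⁻ x, Ω.indicator (fun x => ∑' n, F n x) x ∂μ ≠ ⊤ := by
    rwa [lintegral_indicator hΩ, lintegral_tsum fun n => (hF n).aemeasurable]
  filter_upwards [ae_setLIntegral_line_ne_top hμ u ((Measurable.tsum hF).indicator hΩ) hint]
    with x hx a b hab
  have hm : ∀ n, Measurable fun t : ℝ => F n (x + t • incl μ u) := fun n =>
    (hF n).comp (by fun_prop)
  have hsub : Set.Icc a b ⊆ Set.Icc (-(max |a| |b|)) (max |a| |b|) :=
    Set.Icc_subset_Icc (neg_le.1 ((neg_le_abs a).trans (le_max_left _ _)))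
      ((le_abs_self b).trans (le_max_right _ _))
  rw [← lintegral_tsum fun n => (hm n).aemeasurable]
  refine ne_top_of_le_ne_top (hx (max |a| |b|)) (le_trans ?_ (lintegral_mono_set hsub))
  refine setLIntegral_mono' measurableSet_Icc fun t ht => ?_
  rw [Set.indicator_of_mem (hab t ht)]

theorem ae_exists_limit_primitiveOn (hμ : IsCentered μ) (hΩ : MeasurableSet Ω)
    {f g : ℕ → X → ℝ} {φ γ : X → ℝ} (hfm : ∀ n, Measurable (f n)) (hgm : ∀ n, Measurable (g n))
    (hφm : Measurable φ) (hγm : Measurable γ) (h : ∀ n, LineAC u Ω (f n) (g n))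
    (hf : ∑' n, ∫⁻ x in Ω, ‖f n x - φ x‖ₑ ∂μ ≠ ⊤) (hg : ∑' n, ∫⁻ x in Ω, ‖g n x - γ x‖ₑ ∂μ ≠ ⊤) :
    ∀ᵐ x ∂μ, ∀ a b : ℝ, a < b → (∀ t ∈ Set.Icc a b, x + t • incl μ u ∈ Ω) →
      ∃ (C : ℕ → ℝ) (c : ℝ),
        (∀ n, PrimitiveOn (fun t => f n (x + t • incl μ u)) (fun t => g n (x + t • incl μ u))
          a b (C n)) ∧
        PrimitiveOn (fun t => φ (x + t • incl μ u)) (fun t => γ (x + t • incl μ u)) a b c ∧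
        ∀ t ∈ Set.Icc a b, Tendsto (fun n => C n + ∫ s in a..t, g n (x + s • incl μ u)) atTop
          (𝓝 (c + ∫ s in a..t, γ (x + s • incl μ u))) := by
  filter_upwards [ae_all_iff.2 h,
    ae_tsum_lintegral_line_ne_top hμ u hΩ (fun n => ((hfm n).sub hφm).enorm) hf,
    ae_tsum_lintegral_line_ne_top hμ u hΩ (fun n => ((hgm n).sub hγm).enorm) hg]
    with x hx hxf hxg a b hab hmem
  choose C hC using fun n => hx n a b hab hmem
  have hline : Measurable fun t : ℝ => x + t • incl μ u := by fun_prop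
  obtain ⟨c, hc⟩ := PrimitiveOn.exists_limit hab (fun n => (hfm n).comp hline)
    (fun n => (hgm n).comp hline) (hφm.comp hline) (hγm.comp hline) hC (hxf a b hmem)
    (hxg a b hmem)
  exact ⟨C, c, hC, hc⟩

theorem LineAC.of_tendsto (hμ : IsCentered μ) (hΩ : MeasurableSet Ω)
    {f g : ℕ → X → ℝ} {φ γ : X → ℝ} (hfm : ∀ n, Measurable (f n)) (hgm : ∀ n, Measurable (g n))
    (hφm : Measurable φ) (hγm : Measurable γ) (h : ∀ n, LineAC u Ω (f n) (g n))
    (hf : Tendsto (fun n => ∫⁻ x in Ω, ‖f n x - φ x‖ₑ ∂μ) atTop (𝓝 0))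
    (hg : Tendsto (fun n => ∫⁻ x in Ω, ‖g n x - γ x‖ₑ ∂μ) atTop (𝓝 0)) : LineAC u Ω φ γ := by
  have hfg := hf.add hg
  rw [add_zero] at hfg
  obtain ⟨θ, hθ⟩ := exists_tsum_comp_ne_top hfg
  rw [ENNReal.tsum_add, ENNReal.add_ne_top] at hθ
  filter_upwards [ae_exists_limit_primitiveOn hμ hΩ (fun n => hfm (θ n)) (fun n => hgm (θ n))
    hφm hγm (fun n => h (θ n)) hθ.1 hθ.2] with x hx a b hab hmem
  obtain ⟨-, c, -, hc, -⟩ := hx a b hab hmem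
  exact ⟨c, hc⟩

end LineAC

theorem IsCyl.contDiff {X : Type*} [NormedAddCommGroup X] [NormedSpace ℝ X] {f : X → ℝ} {k : ℕ∞}
    (hf : IsCyl k f) : ContDiff ℝ k f := by
  obtain ⟨n, L, g, hg, rfl⟩ := hf
  exact hg.1.comp (contDiff_pi.2 fun i => (L i).contDiff)

section Sobolev

variable {X : Type*} [NormedAddCommGroup X] [NormedSpace ℝ X] [MeasurableSpace X] [BorelSpace X]
  {μ : Measure X} {ι : Type*}

theorem contDiff_hPartial (e : HilbertBasis ι ℝ (CM μ)) {f : X → ℝ} (hf : ContDiff ℝ (⊤ : ℕ∞) f)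
    (j : ℕ) (s : Fin j → ι) : ContDiff ℝ 1 fun x => hPartial e f j x s :=
  (ContinuousMultilinearMap.apply ℝ (fun _ : Fin j => X) ℝ
    fun a => incl μ (e (s a))).contDiff.comp
    (hf.iteratedFDeriv_right (m := 1) (i := j) (by exact_mod_cast le_top))

theorem fderiv_hPartial (e : HilbertBasis ι ℝ (CM μ)) {f : X → ℝ} (hf : ContDiff ℝ (⊤ : ℕ∞) f)
    {j : ℕ} (s : Fin j → ι) (i : ι) (x : X) :
    fderiv ℝ (fun x => hPartial e f j x s) x (incl μ (e i)) =
      hPartial e f (j + 1) x (Fin.cons i s) := by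
  have hdiff : DifferentiableAt ℝ (iteratedFDeriv ℝ j f) x :=
    hf.differentiable_iteratedFDeriv (by exact_mod_cast ENat.natCast_lt_top j) x
  have hcomp := (ContinuousMultilinearMap.apply ℝ (fun _ : Fin j => X) ℝ
    fun a => incl μ (e (s a))).hasFDerivAt.comp x hdiff.hasFDerivAt
  have heq : (fun x => hPartial e f j x s) = ContinuousMultilinearMap.apply ℝ (fun _ : Fin j => X)
      ℝ (fun a => incl μ (e (s a))) ∘ iteratedFDeriv ℝ j f := rfl
  rw [heq, hcomp.fderiv, hPartial, iteratedFDeriv_succ_apply_left]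
  rfl

variable [CompleteSpace X] [SecondCountableTopology X] [IsGaussian μ]
  {e : HilbertBasis ι ℝ (CM μ)} {u : CM μ} {p : ℝ} {α β : ℝ} {i i' : ι}

theorem lineAC_hPartial (Ω : Set X) {f : X → ℝ} (hf : ContDiff ℝ (⊤ : ℕ∞) f) {j : ℕ}
    (s : Fin j → ι) (hu : u = α • e i + β • e i') :
    LineAC u Ω (fun x => hPartial e f j x s) fun x =>
      α * hPartial e f (j + 1) x (Fin.cons i s) + β * hPartial e f (j + 1) x (Fin.cons i' s) := by
  convert lineAC_of_contDiff u Ω (contDiff_hPartial e hf j s) using 2 with x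
  rw [hu, incl_add, incl_smul, incl_smul, map_add, map_smul, map_smul, fderiv_hPartial e hf,
    fderiv_hPartial e hf, smul_eq_mul, smul_eq_mul]

theorem IsSobolev.lineAC (hμ : IsCentered μ) {Ω : Set X} (hΩ : MeasurableSet Ω) (hp : 1 < p)
    {k : ℕ} {D : (j : ℕ) → X → (Fin j → ι) → ℝ} (hD : IsSobolev e Ω k p D) {j : ℕ} (hj : j < k)
    (s : Fin j → ι) (hu : u = α • e i + β • e i') :
    LineAC u Ω (fun x => D j x s) fun x =>
      α * D (j + 1) x (Fin.cons i s) + β * D (j + 1) x (Fin.cons i' s) := by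
  obtain ⟨hm, f, hf, hlim⟩ := hD
  have hfC : ∀ n, ContDiff ℝ (⊤ : ℕ∞) (f n) := fun n => (hf n).contDiff
  have hfm : ∀ n j (s : Fin j → ι), Measurable fun x => hPartial e (f n) j x s := fun n j s =>
    (contDiff_hPartial e (hfC n) j s).continuous.measurable
  exact .of_tendsto hμ hΩ (fun n => hfm n j s)
    (fun n => ((hfm n (j + 1) _).const_mul α).add ((hfm n (j + 1) _).const_mul β))
    (hm j hj.le s) (((hm (j + 1) hj _).const_mul α).add ((hm (j + 1) hj _).const_mul β))
    (fun n => lineAC_hPartial Ω (hfC n) s hu)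
    (tendsto_lintegral_enorm_sub_of_l2norm hp (hm j hj.le) (fun n s => hfm n j s)
      (hlim j hj.le) s)
    (tendsto_lintegral_enorm_linearCombination_sub hp (hm (j + 1) hj)
      (fun n s => hfm n (j + 1) s) (hlim (j + 1) hj) α β _ _)

end Sobolev

section TraceLines

variable {X : Type*} [NormedAddCommGroup X] [NormedSpace ℝ X] [MeasurableSpace X] [BorelSpace X]
  [CompleteSpace X] [SecondCountableTopology X] {μ : Measure X} [IsGaussian μ] {u : CM μ}

theorem ae_hasEndValue_of_limit (hμ : IsCentered μ) {Ω : Set X} (hΩ : MeasurableSet Ω)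
    {f g : ℕ → X → ℝ} {φ γ : X → ℝ} (hfc : ∀ n, ContinuousOn (f n) Ω)
    (hfm : ∀ n, Measurable (f n)) (hgm : ∀ n, Measurable (g n)) (hφm : Measurable φ)
    (hγm : Measurable γ) (h : ∀ n, LineAC u Ω (f n) (g n))
    (hf : ∑' n, ∫⁻ x in Ω, ‖f n x - φ x‖ₑ ∂μ ≠ ⊤) (hg : ∑' n, ∫⁻ x in Ω, ‖g n x - γ x‖ₑ ∂μ ≠ ⊤) :
    ∀ᵐ x ∂μ, ∀ a b : ℝ, a < b → (∀ t ∈ Set.Icc a b, x + t • incl μ u ∈ Ω) →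
      ∀ τ, Tendsto (fun n => f n (x + b • incl μ u)) atTop (𝓝 τ) →
        HasEndValue (fun t => φ (x + t • incl μ u)) a b τ := by
  filter_upwards [ae_exists_limit_primitiveOn hμ hΩ hfm hgm hφm hγm h hf hg]
    with x hx a b hab hmem τ hτ
  obtain ⟨C, c, hC, hc, hlim⟩ := hx a b hab hmem
  have hb : b ∈ Set.Icc a b := ⟨hab.le, le_rfl⟩
  have hline : Continuous fun t : ℝ => x + t • incl μ u := by fun_prop
  have hval : ∀ n, f n (x + b • incl μ u) = C n + ∫ s in a..b, g n (x + s • incl μ u) := fun n =>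
    HasEndValue.eq_of_continuousWithinAt ⟨_, (hC n).continuousOn hab.le, (hC n).2, rfl⟩ hab
      (((hfc n).comp hline.continuousOn hmem b hb).mono_of_mem_nhdsWithin (Icc_mem_nhdsLT hab))
  exact ⟨_, hc.continuousOn hab.le, hc.2,
    tendsto_nhds_unique (hlim b hb) (hτ.congr hval)⟩

variable {ι : Type*} {e : HilbertBasis ι ℝ (CM μ)} {G : X → ℝ} {p : ℝ}

theorem IsTrace.ae_hasEndValue (hμ : IsCentered μ) (hG : Measurable G) (hp : 1 < p) {φ T : X → ℝ}
    (hT : IsTrace e G p φ T) {α β : ℝ} {j k : ι} (hu : u = α • e j + β • e k) (hu0 : u ≠ 0) :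
    ∀ᵐ x ∂μ, ∀ a b : ℝ, a < b → (∀ t ∈ Set.Icc a b, G (x + t • incl μ u) ≤ 0) →
      G (x + b • incl μ u) = 0 →
      HasEndValue (fun t => φ (x + t • incl μ u)) a b (T (x + b • incl μ u)) := by
  obtain ⟨hTm, D, ψ, Dψ, hD, hφ, hψ, hlim, hρ⟩ := hT
  have hΩ : MeasurableSet {x | G x ≤ 0} := hG measurableSet_Iic
  have hψD : ∀ n, IsSobolev e {x | G x ≤ 0} 1 p (Dψ n) := fun n => (hψ n).2.2.1
  have hDm := hD.1
  have hDψm := fun n => (hψD n).1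
  obtain rfl : (fun x => D 0 x Fin.elim0) = φ := by rw [hφ]; rfl
  obtain rfl : (fun n x => Dψ n 0 x Fin.elim0) = ψ := funext fun n => by rw [(hψ n).2.2.2]; rfl
  have hsum := ((tendsto_lintegral_enorm_sub_of_l2norm hp (hDm 0 zero_le_one)
    (fun n => hDψm n 0 zero_le_one) (hlim 0 zero_le_one) Fin.elim0).add
    (tendsto_lintegral_enorm_linearCombination_sub hp (hDm 1 le_rfl) (fun n => hDψm n 1 le_rfl)
      (hlim 1 le_rfl) α β (Fin.cons j Fin.elim0) (Fin.cons k Fin.elim0))).add hρ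
  rw [add_zero, add_zero] at hsum
  obtain ⟨θ, hθ⟩ := exists_tsum_comp_ne_top hsum
  rw [ENNReal.tsum_add, ENNReal.tsum_add, ENNReal.add_ne_top, ENNReal.add_ne_top] at hθ
  obtain ⟨⟨hθ0, hθ1⟩, hθρ⟩ := hθ
  have hψT := rhoAE_tendsto_zero (hG (measurableSet_singleton 0))
    (fun n => ((hDψm (θ n) 0 zero_le_one Fin.elim0).sub hTm).enorm) hθρ
  have hcont : ∀ n, ContinuousOn (fun x => Dψ (θ n) 0 x Fin.elim0) {x | G x ≤ 0} := fun n =>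
    (hψ (θ n)).1.elim fun K hK => hK.continuousOn
  filter_upwards [hψT.ae_line hu0, ae_hasEndValue_of_limit hμ hΩ hcont
    (fun n => hDψm (θ n) 0 zero_le_one _)
    (fun n => ((hDψm (θ n) 1 le_rfl _).const_mul α).add ((hDψm (θ n) 1 le_rfl _).const_mul β))
    (hDm 0 zero_le_one _) (((hDm 1 le_rfl _).const_mul α).add ((hDm 1 le_rfl _).const_mul β))
    (fun n => (hψD (θ n)).lineAC hμ hΩ hp one_pos _ hu) hθ0 hθ1] with x hxT hx a b hab hmem hb
  refine hx a b hab hmem _ ?_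
  rw [tendsto_iff_edist_tendsto_0]
  simpa only [edist_eq_enorm_sub, Pi.sub_apply] using hxT b hb

end TraceLines

theorem exists_lt_forall_Icc_nonpos {f : ℝ → ℝ} {f' b : ℝ} (hf : HasDerivAt f f' b) (h0 : f b = 0)
    (hf' : 0 < f') : ∃ a < b, ∀ t ∈ Set.Icc a b, f t ≤ 0 := by
  have hslope := (hasDerivAt_iff_tendsto_slope.1 hf).mono_left (nhdsLT_le_nhdsNE b)
  have hneg : ∀ᶠ t in 𝓝[<] b, f t ≤ 0 := by
    filter_upwards [hslope.eventually_const_lt hf', self_mem_nhdsWithin] with t ht htb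
    rw [slope_def_field, h0, sub_zero] at ht
    by_contra! hft
    exact ht.not_ge (div_nonpos_of_nonneg_of_nonpos hft.le (sub_neg.2 htb).le)
  obtain ⟨a, hab, ha⟩ := (mem_nhdsLT_iff_exists_Ico_subset).1 hneg
  refine ⟨a, hab, fun t ht => ?_⟩
  rcases ht.2.eq_or_lt with rfl | htb
  exacts [h0.le, ha ⟨ht.1, htb⟩]

theorem add_smul_add_sub_smul {V : Type*} [AddCommGroup V] [Module ℝ V] (x w : V) (b t : ℝ) :
    x + b • w + (t - b) • w = x + t • w := by
  module

theorem hasDerivAt_line_of_hasDerivAt_zero {V E : Type*} [AddCommGroup V] [Module ℝ V]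
    [NormedAddCommGroup E] [NormedSpace ℝ E] {f : V → E} {x w : V} {b : ℝ} {f' : E}
    (h : HasDerivAt (fun t : ℝ => f (x + b • w + t • w)) f' 0) :
    HasDerivAt (fun t : ℝ => f (x + t • w)) f' b := by
  rw [← sub_self b] at h
  simpa only [add_smul_add_sub_smul] using h.comp_sub_const b b

theorem exists_int_lt_mul (a : ℝ) {b : ℝ} (hb : b ≠ 0) : ∃ n : ℤ, a < n * b := by
  obtain ⟨n, hn⟩ := exists_int_gt (a / |b|)
  rw [div_lt_iff₀ (abs_pos.2 hb)] at hn
  rcases abs_choice b with h | h <;> rw [h] at hn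
  exacts [⟨n, hn⟩, ⟨-n, by push_cast; linarith⟩]

theorem eq_of_forall_int_linearCombination_eq {a b s t s' t' : ℝ} (hb : b ≠ 0)
    (h : ∀ α β : ℤ, 0 < α * a + β * b → α * s + β * t = α * s' + β * t') : s = s' := by
  obtain ⟨β, hβ⟩ := exists_int_lt_mul (2 * |a|) hb
  have ha := neg_abs_le a
  have h₁ := h 1 β (by push_cast; linarith [abs_nonneg a])
  have h₂ := h 2 β (by push_cast; linarith)
  push_cast at h₁ h₂
  linarith

section HilbertBasis

variable {𝕜 H ι : Type*} [RCLike 𝕜] [NormedAddCommGroup H] [InnerProductSpace 𝕜 H]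

theorem eq_of_forall_inner_basis_eq (e : HilbertBasis ι 𝕜 H) {v w : H}
    (h : ∀ i, inner 𝕜 v (e i) = inner 𝕜 w (e i)) : v = w := by
  refine e.repr.injective (lp.ext (funext fun i => ?_))
  rw [e.repr_apply_apply, e.repr_apply_apply, ← inner_conj_symm, h, inner_conj_symm]

theorem exists_inner_basis_ne_zero (e : HilbertBasis ι 𝕜 H) {v : H} (hv : v ≠ 0) :
    ∃ i, inner 𝕜 v (e i) ≠ 0 := by
  by_contra! h
  exact hv (eq_of_forall_inner_basis_eq e fun i => by rw [h i, inner_zero_left])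

theorem clm_eq_of_forall_inner_basis_eq (e : HilbertBasis ι 𝕜 H) {A B : H →L[𝕜] H}
    (h : ∀ i j, inner 𝕜 (A (e j)) (e i) = inner 𝕜 (B (e j)) (e i)) : A = B := by
  refine ContinuousLinearMap.ext_on
    (Submodule.dense_iff_topologicalClosure_eq_top.2 e.dense_span) ?_
  rintro _ ⟨j, rfl⟩
  exact eq_of_forall_inner_basis_eq e fun i => h i j

end HilbertBasis

section Restriction

variable {X : Type*} [NormedAddCommGroup X] [NormedSpace ℝ X] [MeasurableSpace X] [BorelSpace X]
  {μ : Measure X} {G : X → ℝ} {DG : X → CM μ}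

theorem ConvexRegularLevel.rhoAE_of_forall_smul_basis
    {ι : Type*} [Countable ι] (h : ConvexRegularLevel G DG) (e : HilbertBasis ι ℝ (CM μ))
    {Q : X → Prop}
    (hQ : ∀ (σ : ℝ) (k : ι), RhoAE μ (G ⁻¹' {0}) fun y => 0 < ⟪DG y, σ • e k⟫_ℝ → Q y) :
    RhoAE μ (G ⁻¹' {0}) Q := by
  refine (((RhoAE.forall (hQ 1)).and (RhoAE.forall (hQ (-1)))).and h.ne_zero).mono ?_
  rintro y - ⟨⟨hpos, hneg⟩, hne⟩
  obtain ⟨k, hk⟩ := exists_inner_basis_ne_zero e hne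
  rcases hk.lt_or_gt with hk | hk
  · exact hneg k (by rw [CM.inner_smul_right]; linarith)
  · exact hpos k (by rw [CM.inner_smul_right]; linarith)

variable [CompleteSpace X] [SecondCountableTopology X] [IsGaussian μ] {u : CM μ}

theorem ConvexRegularLevel.rhoAE_exists_segment (h : ConvexRegularLevel G DG) (hμ : IsCentered μ)
    {P : X → Prop} (hP : u ≠ 0 → ∀ᵐ x ∂μ, P x) :
    RhoAE μ (G ⁻¹' {0}) fun y => 0 < ⟪DG y, u⟫_ℝ → ∃ (x : X) (a b : ℝ), a < b ∧
      x + b • incl μ u = y ∧ (∀ t ∈ Set.Icc a b, G (x + t • incl μ u) ≤ 0) ∧ P x := by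
  rcases eq_or_ne u 0 with rfl | hu
  · exact h.ne_zero.mono fun y _ _ hpos => absurd hpos (by simp)
  have hline : RhoAE μ (G ⁻¹' {0}) fun y => 0 < ⟪DG y, u⟫_ℝ →
      ∃ (x : X) (b : ℝ), x + b • incl μ u = y ∧ P x := by
    refine h.rhoAE_of_invariant hμ ?_ ((hP hu).mono fun x hx => ⟨x, 0, by simp, hx⟩)
    rintro _ s ⟨x, b, rfl, hx⟩
    exact ⟨x, b + s, by rw [add_smul, add_assoc], hx⟩
  refine (hline.and h.hasHDerivAt).mono ?_
  rintro y hy ⟨hyline, hderiv⟩ hpos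
  obtain ⟨x, b, rfl, hx⟩ := hyline hpos
  obtain ⟨a, hab, hneg⟩ := exists_lt_forall_Icc_nonpos
    (hasDerivAt_line_of_hasDerivAt_zero (hderiv.hasDerivAt u)) hy hpos
  exact ⟨x, a, b, hab, rfl, hneg, hx⟩

variable {ι : Type*} {e : HilbertBasis ι ℝ (CM μ)} {p : ℝ} {α β : ℝ} {j k : ι}

theorem IsTrace.rhoAE_eq_of_continuousAt (h : ConvexRegularLevel G DG) (hμ : IsCentered μ)
    (hp : 1 < p) {φ T : X → ℝ} (hT : IsTrace e G p φ T) (hu : u = α • e j + β • e k)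
    (hφ : RhoAE μ (G ⁻¹' {0}) fun y => ContinuousAt (fun t : ℝ => φ (y + t • incl μ u)) 0) :
    RhoAE μ (G ⁻¹' {0}) fun y => 0 < ⟪DG y, u⟫_ℝ → T y = φ y := by
  refine ((h.rhoAE_exists_segment hμ (hT.ae_hasEndValue hμ h.measurable hp hu)).and hφ).mono ?_
  rintro y hy ⟨hseg, hcont⟩ hpos
  obtain ⟨x, a, b, hab, rfl, hneg, hend⟩ := hseg hpos
  refine ((hend a b hab hneg hy).eq_of_continuousWithinAt hab
    (ContinuousAt.continuousWithinAt ?_)).symm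
  rw [← sub_self b] at hcont
  simpa only [add_smul_add_sub_smul] using
    ContinuousAt.comp' (f := fun t => t - b) (x := b) hcont (by fun_prop)

theorem rhoAE_linearCombination_trace_eq (h : ConvexRegularLevel G DG) (hμ : IsCentered μ)
    (hp : 1 < p) {q : ℝ} (hq : 1 < q) {D : (m : ℕ) → X → (Fin m → ι) → ℝ} {r : ℕ} {m : ℕ}
    (hm : m < r) (hD : IsSobolev e Set.univ r q D) {s : Fin m → ι} {Tj Tk : X → ℝ}
    (hTj : IsTrace e G p (fun x => D (m + 1) x (Fin.cons j s)) Tj)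
    (hTk : IsTrace e G p (fun x => D (m + 1) x (Fin.cons k s)) Tk)
    (hu : u = α • e j + β • e k) {d : X → ℝ}
    (hd : RhoAE μ (G ⁻¹' {0}) fun y =>
      HasDerivAt (fun t : ℝ => D m (y + t • incl μ u) s) (d y) 0) :
    RhoAE μ (G ⁻¹' {0}) fun y => 0 < ⟪DG y, u⟫_ℝ → α * Tj y + β * Tk y = d y := by
  have hreg := h.rhoAE_exists_segment hμ (u := u) fun hu0 =>
    ((hTj.ae_hasEndValue hμ h.measurable hp hu hu0).and
      (hTk.ae_hasEndValue hμ h.measurable hp hu hu0)).and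
        (hD.lineAC hμ .univ hq hm s hu)
  refine (hreg.and hd).mono ?_
  rintro y hy ⟨hseg, hderiv⟩ hpos
  obtain ⟨x, a, b, hab, rfl, hneg, ⟨hendj, hendk⟩, hprim⟩ := hseg hpos
  obtain ⟨C, hC⟩ := hprim a b hab fun _ _ => Set.mem_univ _
  exact (hC.deriv_eq_of_hasEndValue hab
    (hasDerivAt_line_of_hasDerivAt_zero (f := fun x => D m x s) hderiv)
    ((hendj a b hab hneg hy).linearCombination (hendk a b hab hneg hy) α β)).symm

variable [Countable ι]

theorem IsVectorTrace.rhoAE_eq (h : ConvexRegularLevel G DG) (hμ : IsCentered μ) (hp : 1 < p)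
    {F TF : X → CM μ} (hT : IsVectorTrace e G p F TF)
    (hF : RhoAE μ (G ⁻¹' {0}) fun y =>
      ∀ k : CM μ, ContinuousAt (fun t : ℝ => F (y + t • incl μ k)) 0) :
    RhoAE μ (G ⁻¹' {0}) fun y => TF y = F y := by
  have hcoord : ∀ i, RhoAE μ (G ⁻¹' {0}) fun y => ⟪TF y, e i⟫_ℝ = ⟪F y, e i⟫_ℝ := fun i =>
    h.rhoAE_of_forall_smul_basis e fun σ k =>
      (hT i).rhoAE_eq_of_continuousAt h hμ hp (u := σ • e k) (α := 0) (β := σ) (j := k)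
        (k := k) (by rw [zero_smul, zero_add])
        (hF.mono fun y _ hy => (hy _).inner continuousAt_const)
  exact (RhoAE.forall hcoord).mono fun y _ hy => eq_of_forall_inner_basis_eq e hy

theorem IsOperatorTrace.rhoAE_eq (h : ConvexRegularLevel G DG) (hμ : IsCentered μ) (hp : 1 < p)
    {F : X → CM μ} {A TA : X → CM μ →L[ℝ] CM μ} (hT : IsOperatorTrace e G p A TA) {q : ℝ}
    (hq : 1 < q) {D : (m : ℕ) → X → (Fin m → ι) → ℝ} (hD : IsSobolev e Set.univ 2 q D)
    (hF : D 1 = coeff₁ e F) (hA : D 2 = coeff₂ e A)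
    (hFA : RhoAE μ (G ⁻¹' {0}) fun y => HasHDerivAt F (A y) y) :
    RhoAE μ (G ⁻¹' {0}) fun y => TA y = A y := by
  have hcoeff : ∀ (i j : ι), (fun x => D 2 x (Fin.cons j fun _ => i)) =
      fun x => ⟪A x (e j), e i⟫_ℝ := fun i j => by rw [hA]; rfl
  have hcomb : ∀ (i j k : ι) (α β : ℤ), RhoAE μ (G ⁻¹' {0}) fun y =>
      0 < ⟪DG y, (α : ℝ) • e j + (β : ℝ) • e k⟫_ℝ →
        α * ⟪TA y (e j), e i⟫_ℝ + β * ⟪TA y (e k), e i⟫_ℝ =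
          ⟪A y ((α : ℝ) • e j + (β : ℝ) • e k), e i⟫_ℝ := fun i j k α β => by
    refine rhoAE_linearCombination_trace_eq h hμ hp hq one_lt_two hD (s := fun _ => i)
      (hcoeff i j ▸ hT i j) (hcoeff i k ▸ hT i k) rfl (hFA.mono fun y _ hy => ?_)
    simpa only [hF, coeff₁, inner_zero_right, zero_add] using
      (hy.hasDerivAt ((α : ℝ) • e j + (β : ℝ) • e k)).inner ℝ (hasDerivAt_const (0 : ℝ) (e i))
  refine ((RhoAE.forall fun i => RhoAE.forall fun j => RhoAE.forall fun k => RhoAE.forall fun α =>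
    RhoAE.forall fun β => hcomb i j k α β).and h.ne_zero).mono ?_
  rintro y - ⟨hy, hne⟩
  obtain ⟨k, hk⟩ := exists_inner_basis_ne_zero e hne
  refine clm_eq_of_forall_inner_basis_eq e fun i j => eq_of_forall_int_linearCombination_eq
    (t := ⟪TA y (e k), e i⟫_ℝ) (t' := ⟪A y (e k), e i⟫_ℝ) (a := ⟪DG y, e j⟫_ℝ) hk
      fun α β hpos => ?_
  rw [hy i j k α β (by rwa [inner_add_right, CM.inner_smul_right, CM.inner_smul_right]), map_add,
    map_smul, map_smul, inner_add_left, CM.inner_smul_left, CM.inner_smul_left]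

end Restriction

/-! ### Differentiation along the level set -/

section TangentCone

theorem frequently_eq_zero_of_tendsto_mul {α : Type*} {l : Filter α} [l.NeBot] {g : α → ℝ → ℝ}
    {a : ℝ} (ha : 0 < a) (hcont : ∀ᶠ i in l, Continuous (g i))
    (hg : ∀ s, Tendsto (fun i => g i s) l (𝓝 (s * a))) :
    ∃ᶠ q in l ×ˢ 𝓝 (0 : ℝ), g q.1 q.2 = 0 := by
  intro hne
  obtain ⟨p, hp, r, hr, hpr⟩ := eventually_prod_iff.1 hne
  obtain ⟨ε, hε, hεr⟩ := (nhds_basis_Icc_pos (0 : ℝ)).eventually_iff.1 hr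
  rw [zero_sub, zero_add] at hεr
  have hpos := (hg ε).eventually_const_lt (mul_pos hε ha)
  have hneg := (hg (-ε)).eventually_lt_const (mul_neg_of_neg_of_pos (neg_lt_zero.2 hε) ha)
  obtain ⟨i, hi, hci, hposi, hnegi⟩ := (hp.and (hcont.and (hpos.and hneg))).exists
  obtain ⟨s, hs, hs0⟩ := intermediate_value_Icc (by linarith : -ε ≤ ε) hci.continuousOn
    ⟨hnegi.le, hposi.le⟩
  exact hpr hi (hεr hs) hs0

variable {E : Type*} [NormedAddCommGroup E] [NormedSpace ℝ E]

theorem mem_tangentConeAt_zeros_add_smul {f : E → ℝ} {f' : E →L[ℝ] ℝ} {x u v : E} {Z : Set E}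
    (hf : HasFDerivAt f f' x) (hx : f x = 0) (hu : 0 < f' u) (hv : f' v = 0)
    (hcont : ∀ z ∈ Z, Continuous fun s : ℝ => f (z + s • u)) (hvZ : v ∈ tangentConeAt ℝ Z x) :
    v ∈ tangentConeAt ℝ {y | f y = 0 ∧ ∃ z ∈ Z, ∃ s : ℝ, y = z + s • u} x := by
  obtain ⟨c, d, hc, hdZ, hcd⟩ := mem_tangentConeAt_iff_exists_seq_norm_tendsto_atTop.1 hvZ
  have hc0 : ∀ᶠ n in atTop, c n ≠ 0 := eventually_ne_of_tendsto_norm_atTop hc 0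
  have hcds : ∀ s : ℝ, Tendsto (fun q : ℕ × ℝ => c q.1 • (d q.1 + (q.2 / c q.1) • u))
      (atTop ×ˢ 𝓝 s) (𝓝 (v + s • u)) := fun s => by
    refine ((hcd.comp tendsto_fst).add (tendsto_snd.smul_const u)).congr' ?_
    refine (tendsto_fst.eventually hc0).mono fun q hq => ?_
    simp only [Function.comp_apply, smul_add, smul_smul, mul_div_cancel₀ _ hq]
  have hzero : ∃ᶠ q in atTop ×ˢ 𝓝 (0 : ℝ),
      c q.1 * f (x + (d q.1 + (q.2 / c q.1) • u)) = 0 := by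
    refine frequently_eq_zero_of_tendsto_mul
      (g := fun n s => c n * f (x + (d n + (s / c n) • u))) hu (hdZ.mono fun n hn => ?_) fun s => ?_
    · refine continuous_const.mul ?_
      simpa only [add_assoc] using
        (hcont _ hn).comp' (by fun_prop : Continuous fun s : ℝ => s / c n)
    · have hcdn : Tendsto (fun n => c n • (d n + (s / c n) • u)) atTop (𝓝 (v + s • u)) :=
        (hcds s).comp (tendsto_id.prodMk tendsto_const_nhds)
      simpa only [hx, sub_zero, smul_eq_mul, map_add, map_smul, hv, zero_add] using
        (hasFDerivWithinAt_univ.2 hf).lim (tangentConeAt.lim_zero _ hc hcdn)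
          (Eventually.of_forall fun _ => Set.mem_univ _) hcdn
  refine mem_tangentConeAt_of_frequently (atTop ×ˢ 𝓝 (0 : ℝ)) (fun q => c q.1)
    (fun q => d q.1 + (q.2 / c q.1) • u)
    (tangentConeAt.lim_zero _ (hc.comp tendsto_fst) (hcds 0)) ?_ (by simpa using hcds 0)
  refine (hzero.and_eventually (tendsto_fst.eventually (hc0.and hdZ))).mono ?_
  rintro ⟨n, s⟩ ⟨hn0, hcn, hn⟩
  exact ⟨(mul_eq_zero.1 hn0).resolve_left hcn, _, hn, _, (add_assoc _ _ _).symm⟩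

end TangentCone

section Tangential

variable {X : Type*} [NormedAddCommGroup X] [NormedSpace ℝ X] [MeasurableSpace X] [BorelSpace X]
  {μ : Measure X} {G : X → ℝ} {DG Φ : X → CM μ} {u : CM μ}

theorem mem_tangentConeAt_image_of_dense {E F : Type*} [NormedAddCommGroup E] [NormedSpace ℝ E]
    [NormedAddCommGroup F] [NormedSpace ℝ F] (T : E →L[ℝ] F) {Z : Set E} (hZ : Dense Z) (a : E) :
    T a ∈ tangentConeAt ℝ (T '' Z) 0 := by
  rw [← map_zero T]
  refine T.hasFDerivWithinAt.mapsTo_tangent_cone ?_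
  rw [← tangentConeAt_closure, hZ.closure_eq, tangentConeAt_univ]
  exact Set.mem_univ a

variable [CompleteSpace X] [SecondCountableTopology X] [IsGaussian μ]

theorem inner_apply_eq_neg_of_mem_tangentConeAt {y : X} {A : CM μ →L[ℝ] CM μ}
    (hA : HasHDerivAt DG A y) (hΦ : DifferentiableAt ℝ Φ y) (hort : ⟪Φ y, DG y⟫_ℝ = 0)
    {S : Set (CM μ)} (hS : ∀ k ∈ S, ⟪Φ (y + incl μ k), DG (y + incl μ k)⟫_ℝ = 0)
    (htan : Φ y ∈ tangentConeAt ℝ S 0) :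
    ⟪A (Φ y), Φ y⟫_ℝ = -⟪hDeriv Φ y (Φ y), DG y⟫_ℝ := by
  have hΦ' : HasFDerivAt (fun k : CM μ => Φ (y + incl μ k))
      ((fderiv ℝ Φ y).comp (inclCLM μ)) 0 :=
    HasFDerivAt.comp (g := Φ) 0 (by rw [incl_zero, add_zero]; exact hΦ.hasFDerivAt)
      ((inclCLM μ).hasFDerivAt.const_add y)
  have hzero : HasFDerivWithinAt (fun k : CM μ => ⟪Φ (y + incl μ k), DG (y + incl μ k)⟫_ℝ)
      (0 : CM μ →L[ℝ] ℝ) S 0 :=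
    (hasFDerivWithinAt_const (0 : ℝ) 0 S).congr hS (by rw [incl_zero, add_zero, hort])
  have heq := (hΦ'.inner ℝ hA.hasFDerivAt).hasFDerivWithinAt.unique_on hzero htan
  simp only [ContinuousLinearMap.comp_apply, ContinuousLinearMap.prod_apply,
    fderivInnerCLM_apply, incl_zero, add_zero, zero_apply] at heq
  rw [real_inner_comm, eq_neg_iff_add_eq_zero]
  exact heq

theorem mem_tangentConeAt_level_of_dense (hG : ConvexOn ℝ Set.univ G) {y : X} (hy : G y = 0)
    (hDG : HasHDerivAt G (innerSL ℝ (DG y)) y) (hu : 0 < ⟪DG y, u⟫_ℝ) {E : Type*}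
    [NormedAddCommGroup E] [NormedSpace ℝ E] (T : E →L[ℝ] CM μ) {Z : Set E} (hZ : Dense Z)
    {a : E} (ha : ⟪DG y, T a⟫_ℝ = 0) :
    T a ∈ tangentConeAt ℝ
      {k | G (y + incl μ k) = 0 ∧ ∃ w ∈ T '' Z, ∃ s : ℝ, k = w + s • u} 0 := by
  refine mem_tangentConeAt_zeros_add_smul hDG.hasFDerivAt (by rw [incl_zero, add_zero, hy]) hu ha
    (fun w _ => ?_) (mem_tangentConeAt_image_of_dense T hZ a)
  simpa only [incl_add, incl_smul, add_assoc, LinearMap.toSpanSingleton_apply] using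
    continuous_comp_add_linearMap hG (y + incl μ w) (LinearMap.toSpanSingleton ℝ X (incl μ u))

theorem ConvexRegularLevel.rhoAE_ae_add_map (h : ConvexRegularLevel G DG) (hμ : IsCentered μ)
    {P : X → Prop} (hP : RhoAE μ (G ⁻¹' {0}) P) {n : ℕ} (T : (Fin n → ℝ) →L[ℝ] CM μ) :
    RhoAE μ (G ⁻¹' {0}) fun y => 0 < ⟪DG y, u⟫_ℝ → ∀ᵐ z : Fin n → ℝ, ∀ t : ℝ,
      G (y + incl μ (T z) + t • incl μ u) = 0 → P (y + incl μ (T z) + t • incl μ u) := by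
  rcases eq_or_ne u 0 with rfl | hu
  · exact h.ne_zero.mono fun y _ _ hpos => absurd hpos (by simp)
  have hTm : Measurable fun z => incl μ (T z) := (continuous_incl.comp T.continuous).measurable
  refine h.rhoAE_of_invariant hμ (fun x s hx => hx.mono fun z hz t => ?_)
    (ae_ae_add_incl hμ volume hTm (hP.ae_line hu))
  have hshift : x + s • incl μ u + incl μ (T z) + t • incl μ u
      = x + incl μ (T z) + (s + t) • incl μ u := by module
  rw [hshift]
  exact hz (s + t)

variable {ι : Type*} [Countable ι]

theorem ConvexRegularLevel.rhoAE_inner_apply_eq_neg (h : ConvexRegularLevel G DG)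
    (hμ : IsCentered μ) (e : HilbertBasis ι ℝ (CM μ)) {A : X → CM μ →L[ℝ] CM μ}
    (hA : RhoAE μ (G ⁻¹' {0}) fun y => HasHDerivAt DG (A y) y) (hΦ : Differentiable ℝ Φ)
    {V : Submodule ℝ (CM μ)} [FiniteDimensional ℝ V] (hV : ∀ y, Φ y ∈ V)
    (hort : RhoAE μ (G ⁻¹' {0}) fun y => ⟪Φ y, DG y⟫_ℝ = 0) :
    RhoAE μ (G ⁻¹' {0}) fun y => ⟪A y (Φ y), Φ y⟫_ℝ = -⟪hDeriv Φ y (Φ y), DG y⟫_ℝ := by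
  refine h.rhoAE_of_forall_smul_basis e fun σ k => ?_
  set b := (Module.finBasis ℝ V).equivFunL
  set T : (Fin (Module.finrank ℝ V) → ℝ) →L[ℝ] CM μ :=
    V.subtypeL ∘L b.symm.toContinuousLinearMap
  refine (((h.rhoAE_ae_add_map hμ (u := σ • e k) hort T).and hort).and
    (h.hasHDerivAt.and hA)).mono ?_
  rintro y hy ⟨⟨hline, hyort⟩, hDG, hDDG⟩ hpos
  obtain ⟨a, ha⟩ : ∃ a, T a = Φ y := ⟨b ⟨Φ y, hV y⟩, by simp [T]⟩
  have htan := mem_tangentConeAt_level_of_dense h.convexOn hy hDG hpos T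
    (Measure.dense_of_ae (hline hpos)) (a := a) (by rw [ha, real_inner_comm, hyort])
  refine inner_apply_eq_neg_of_mem_tangentConeAt hDDG (hΦ y) hyort ?_ (ha ▸ htan)
  rintro _ ⟨hk, _, ⟨z, hz, rfl⟩, t, rfl⟩
  rw [incl_add, incl_smul, ← add_assoc] at hk ⊢
  exact hz t hk

end Tangential

theorem measurable_inner_of_forall_basis {Ω H ι : Type*} [MeasurableSpace Ω]
    [NormedAddCommGroup H] [InnerProductSpace ℝ H] [Countable ι] (e : HilbertBasis ι ℝ H)
    {A : Ω → H} (hA : ∀ i, Measurable fun x => ⟪A x, e i⟫_ℝ) (w : H) :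
    Measurable fun x => ⟪A x, w⟫_ℝ :=
  measurable_of_tendsto_metrizable' (atTop : Filter (Finset ι))
    (fun s => Finset.measurable_fun_sum s fun i _ => (hA i).mul_const ⟪e i, w⟫_ℝ)
    (tendsto_pi_nhds.2 fun x => e.hasSum_inner_mul_inner (A x) w)

section Domain

variable {X : Type*} [NormedAddCommGroup X] [NormedSpace ℝ X] [MeasurableSpace X] [BorelSpace X]
  {μ : Measure X} {ι : Type*} {e : HilbertBasis ι ℝ (CM μ)} {G : X → ℝ} {DG : X → CM μ}

theorem DomainHyp.convexRegularLevel [Countable ι] {D2G : X → CM μ →L[ℝ] CM μ}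
    (h : DomainHyp e G DG D2G) : ConvexRegularLevel G DG where
  measurable := (h.precise₀ 2 one_lt_two).1 Fin.elim0
  measurable_inner := measurable_inner_of_forall_basis e fun i =>
    (h.precise₁ 2 one_lt_two).1 fun _ => i
  convexOn := h.convex
  hasHDerivAt := h.twiceDifferentiable.mono fun _ _ hx => hx.1
  ne_zero := h.nonzero

theorem IsSobolev.mono {Ω : Set X} {k l : ℕ} {p : ℝ} {D : (j : ℕ) → X → (Fin j → ι) → ℝ}
    (h : IsSobolev e Ω l p D) (hkl : k ≤ l) : IsSobolev e Ω k p D :=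
  ⟨fun j hj => h.1 j (hj.trans hkl), h.2.imp fun _ hf => ⟨hf.1, fun j hj => hf.2 j (hj.trans hkl)⟩⟩

theorem MemZ.differentiable {TDG Φ : X → CM μ} (h : MemZ G TDG Φ) : Differentiable ℝ Φ := by
  obtain ⟨⟨n, v, φ, hφ, rfl⟩, -⟩ := h
  exact Differentiable.fun_sum fun i _ =>
    ((hφ i).contDiff.differentiable (by simp)).smul_const (v i)

theorem MemZ.exists_finiteDimensional {TDG Φ : X → CM μ} (h : MemZ G TDG Φ) :
    ∃ V : Submodule ℝ (CM μ), FiniteDimensional ℝ V ∧ ∀ y, Φ y ∈ V := by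
  obtain ⟨⟨n, v, φ, -, rfl⟩, -⟩ := h
  exact ⟨Submodule.span ℝ (Set.range v), .span_of_finite ℝ (Set.finite_range v), fun y =>
    sum_mem fun i _ => Submodule.smul_mem _ _ (Submodule.subset_span ⟨i, rfl⟩)⟩

end Domain

end GaussLevel

end

theorem mainTheorem10_general {X : Type*} [NormedAddCommGroup X] [NormedSpace ℝ X]
    [CompleteSpace X] [SecondCountableTopology X] [MeasurableSpace X] [BorelSpace X]
    (μ : Measure X) [IsGaussian μ] (hμ : GaussLevel.IsCentered μ)
    {ι : Type*} [Countable ι] (e : HilbertBasis ι ℝ (GaussLevel.CM μ))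
    (G : X → ℝ) (DG : X → GaussLevel.CM μ)
    (hG : GaussLevel.ConvexRegularLevel G DG)
    (D2G : X → GaussLevel.CM μ →L[ℝ] GaussLevel.CM μ)
    (hD2G : GaussLevel.RhoAE μ (G ⁻¹' {0}) fun x => GaussLevel.HasHDerivAt DG (D2G x) x)
    (q : ℝ) (hq : 1 < q) (D : (m : ℕ) → X → (Fin m → ι) → ℝ)
    (hD : GaussLevel.IsSobolev e Set.univ 2 q D) (hD₁ : D 1 = GaussLevel.coeff₁ e DG)
    (hD₂ : D 2 = GaussLevel.coeff₂ e D2G) (p : ℝ) (hp : 1 < p)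
    (TDG : X → GaussLevel.CM μ) (hTDG : GaussLevel.IsVectorTrace e G p DG TDG)
    (TD2G : X → GaussLevel.CM μ →L[ℝ] GaussLevel.CM μ)
    (hTD2G : GaussLevel.IsOperatorTrace e G p D2G TD2G)
    (Φ : X → GaussLevel.CM μ) (hΦ : Differentiable ℝ Φ)
    (V : Submodule ℝ (GaussLevel.CM μ)) [FiniteDimensional ℝ V] (hV : ∀ x, Φ x ∈ V)
    (hort : GaussLevel.RhoAE μ (G ⁻¹' {0}) fun x => ⟪Φ x, TDG x⟫_ℝ = 0) :
    GaussLevel.RhoAE μ (G ⁻¹' {0}) fun x =>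
      ⟪TD2G x (Φ x), Φ x⟫_ℝ = -⟪GaussLevel.hDeriv Φ x (Φ x), TDG x⟫_ℝ := by
  have hgrad : GaussLevel.RhoAE μ (G ⁻¹' {0}) fun x => TDG x = DG x :=
    hTDG.rhoAE_eq hG hμ hp (hD2G.mono fun _ _ hx k => (hx.hasDerivAt k).continuousAt)
  have hhess : GaussLevel.RhoAE μ (G ⁻¹' {0}) fun x => TD2G x = D2G x :=
    hTD2G.rhoAE_eq hG hμ hp hq hD hD₁ hD₂ hD2G
  have htangential := hG.rhoAE_inner_apply_eq_neg hμ e hD2G hΦ hV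
    ((hort.and hgrad).mono fun x _ hx => hx.2 ▸ hx.1)
  refine ((hgrad.and hhess).and htangential).mono ?_
  rintro x - ⟨⟨hx₁, hx₂⟩, hx⟩
  rw [hx₁, hx₂, hx]

theorem mainTheorem10 {X : Type*} [NormedAddCommGroup X] [NormedSpace ℝ X] [CompleteSpace X]
    [SecondCountableTopology X] [MeasurableSpace X] [BorelSpace X]
    (μ : Measure X) [IsGaussian μ] (hμ : GaussLevel.CenteredNondegenerate μ)
    {ι : Type*} [Countable ι] (e : HilbertBasis ι ℝ (GaussLevel.CM μ))
    (he : ∀ i, ∃ L : StrongDual ℝ X, StrongDual.toLp μ 2 L = (e i : Lp ℝ 2 μ))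
    (G : X → ℝ) (DG : X → GaussLevel.CM μ)
    (D2G : X → GaussLevel.CM μ →L[ℝ] GaussLevel.CM μ)
    (hG : GaussLevel.DomainHyp e G DG D2G)
    (p : ℝ) (hp : 1 < p)
    (TDG : X → GaussLevel.CM μ) (hTDG : GaussLevel.IsVectorTrace e G p DG TDG)
    (TD2G : X → GaussLevel.CM μ →L[ℝ] GaussLevel.CM μ)
    (hTD2G : GaussLevel.IsOperatorTrace e G p D2G TD2G)
    (Φ : X → GaussLevel.CM μ) (hΦ : GaussLevel.MemZ G TDG Φ) :
    GaussLevel.RhoAE μ (G ⁻¹' {0}) fun x =>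
      ⟪TD2G x (Φ x), Φ x⟫_ℝ = -⟪GaussLevel.hDeriv Φ x (Φ x), TDG x⟫_ℝ := by
  obtain ⟨D, hD, -, hD₁, hD₂⟩ := hG.sobolev 2 one_lt_two
  obtain ⟨V, hfin, hV⟩ := hΦ.exists_finiteDimensional
  exact mainTheorem10_general μ hμ.1 e G DG hG.convexRegularLevel D2G
    (hG.twiceDifferentiable.mono fun _ _ hx => hx.2) 2 one_lt_two D (hD.mono (by norm_num)) hD₁ hD₂
    p hp TDG hTDG TD2G hTD2G Φ hΦ.differentiable V hV hΦ.2
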